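/- Let $\sigma,\lambda>0$ and $\mu=1+2\lambda/\sigma$. Consider on the whole line the Fokker–Planck equation $$\partial_t f=\frac{\sigma}{2}\,\partial_v^2\big(v^2 f\big)+\lambda\,\partial_v\big((v-1)f\big),\qquad v\in\mathbb R,\ t>0,$$ and its equilibrium density $$f_\infty(v)=\frac{(\mu-1)^\mu}{\Gamma(\mu)}\,\frac{e^{-(\mu-1)/v}}{v^{1+\mu}}\ \ (v>0),\qquad f_\infty(v)=0\ \ (v\le 0).$$ For $0<\alpha<1$ and nonnegative integrable $f,h$ on $\mathbb R$ define the $\alpha$-Hellinger distance by $$d_{H,\alpha}(f,h)=\Big(\int_{\mathbb R}\big(\sqrt{f}-\sqrt{\alpha f+(1-\alpha)h}\big)^2dv\Big)^{1/2}.$$ Let $f_0\ge 0$ be a $C^\infty$ function on $\mathbb R$ with $\int_{\mathbb R} f_0\,dv=1$, $\int_{\mathbb R} v f_0\,dv=1$ and $\int_{\mathbb R}|v|^{3+\delta}f_0\,dv<\infty$ for some $\delta>0$. Let $f(v,t)$ be the classical solution of the equation with initial datum $f_0$, that is: $f$ is continuous on $\mathbb R\times[0,\infty)$ with $f(\cdot,0)=f_0$;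 the derivatives $\partial_t f$, $\partial_v f$, $\partial_v^2 f$ exist and are continuous on $\mathbb R\times(0,\infty)$, where the equation holds; and $f(\cdot,t)$ is integrable for every $t\ge0$, with $\sup_{0\le t\le T}\int_{\mathbb R}|f(v,t)|\,dv<\infty$ for every $T>0$. Let $0<\alpha<1$ and $g(v,t)=\alpha f(v,t)+(1-\alpha)f_\infty(v)$. Then $f\ge 0$, the distance $d_{H,\alpha}(f(t),f_\infty)$ is finite for every $t\ge 0$, the function $t\mapsto d_{H,\alpha}(f(t),f_\infty)$ is nonincreasing on $[0,\infty)$, and for every $t\ge 0$ $$d_{H,\alpha}(f(t),f_\infty)^2=d_{H,\alpha}(f_0,f_\infty)^2-\frac{\sigma}{4}\int_0^t\!\int_0^{\infty}v^2\sqrt{f(v,s)g(v,s)}\,\Big[\partial_v\log\frac{f(v,s)}{g(v,s)}\Big]^2dv\,ds,$$ where the double integral is finite (its integrand is read as $0$ where $f$ vanishes). -/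

import Mathlib

open Set MeasureTheory
open scoped ContDiff

noncomputable section

/-- The Pareto exponent `μ = 1 + 2 λ / σ`. -/
def paretoExponent (σ lam : ℝ) : ℝ := 1 + 2 * lam / σ

/-- The equilibrium density (an inverse Gamma density), continuously extended by zero to `v ≤ 0`. -/
def equilibrium (σ lam : ℝ) (v : ℝ) : ℝ :=
  if 0 < v then
    (paretoExponent σ lam - 1) ^ paretoExponent σ lam / Real.Gamma (paretoExponent σ lam) *
      (Real.exp (-(paretoExponent σ lam - 1) / v) / v ^ (1 + paretoExponent σ lam))
  else 0

/-- `f t v` is a classical solution, with initial datum `f₀`, of the Fokker-Planck equation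
`∂ₜ f = (σ/2) ∂ᵥᵥ (v² f) + λ ∂ᵥ ((v - 1) f)` on the whole line. The function `f` is continuous up
to time zero and of class `C^{1,2}` at positive times, and its `L¹` norm is bounded on bounded time
intervals. The last condition is the integrability under which the Cauchy problem has at most one
solution. Neither the sign, nor the mass, nor any moment of `f t` is prescribed. -/
structure IsFokkerPlanckSolution (σ lam : ℝ) (f₀ : ℝ → ℝ) (f : ℝ → ℝ → ℝ) : Prop where
  initial : ∀ v, f 0 v = f₀ v
  continuousOn : ContinuousOn (fun p : ℝ × ℝ => f p.1 p.2) (Ici 0 ×ˢ univ)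
  differentiable_time : ∀ t, 0 < t → ∀ v, DifferentiableAt ℝ (fun s => f s v) t
  contDiff_space : ∀ t, 0 < t → ContDiff ℝ 2 (f t)
  continuousOn_deriv_time :
    ContinuousOn (fun p : ℝ × ℝ => deriv (fun s => f s p.2) p.1) (Ioi 0 ×ˢ univ)
  continuousOn_deriv_space :
    ContinuousOn (fun p : ℝ × ℝ => deriv (f p.1) p.2) (Ioi 0 ×ˢ univ)
  continuousOn_deriv_two_space :
    ContinuousOn (fun p : ℝ × ℝ => iteratedDeriv 2 (f p.1) p.2) (Ioi 0 ×ˢ univ)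
  equation : ∀ t, 0 < t → ∀ v,
    deriv (fun s => f s v) t =
      σ / 2 * iteratedDeriv 2 (fun w => w ^ 2 * f t w) v
        + lam * deriv (fun w => (w - 1) * f t w) v
  integrable : ∀ t, 0 ≤ t → Integrable (f t)
  bounded_integral : ∀ T : ℝ, ∃ C : ℝ, ∀ t ∈ Icc 0 T, ∫ v, |f t v| ≤ C

/-- The convex combination `α f + (1 - α) h`. -/
def mix (α : ℝ) (f h : ℝ → ℝ) (v : ℝ) : ℝ := α * f v + (1 - α) * h v

/-- The Hellinger distance `(∫ (√f - √h)² dv)^{1/2}`. -/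
def hellingerDist (f h : ℝ → ℝ) : ℝ := √(∫ v, (√(f v) - √(h v)) ^ 2)

/-- The `α`-Hellinger distance: the Hellinger distance between `f` and `α f + (1 - α) h`. -/
def alphaHellingerDist (α : ℝ) (f h : ℝ → ℝ) : ℝ := hellingerDist f (mix α f h)

/-- The production density `v² √(f g) (∂ᵥ log (f / g))²`. It is zero where `f` or `g` vanishes. -/
def hellingerProduction (f g : ℝ → ℝ) (v : ℝ) : ℝ :=
  v ^ 2 * √(f v * g v) * (deriv (fun w => Real.log (f w / g w)) v) ^ 2

end

/-! ### The operator, its adjoint, and the classes of functions involved -/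

open Filter Topology

/-! Write `m` for the equilibrium, `g = α f + (1 - α) m`, and `L` for the Fokker-Planck operator.
Expanding the square, `(√f - √g)² = (1 + α - 2√α) f + (1 - α) m + 2 (√α f - √(f g))`. The mass of
`f` is conserved, so only the gap `√α f - √(f g)` contributes to the change of the squared distance.
On `v > 0` both `f` and `g` solve the equation. The square root of their product is concave and
homogeneous of degree one in the pair, so the zero-order terms cancel and `∂ₜ √(f g) = L √(f g) + P`
with `P = (σ/8) v² √(f g) (∂ᵥ log (f/g))² ≥ 0` (`fokkerPlanckOp_sqrt_mul`). Integrating the equation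
for the gap gives the identity, with the constant `2 · σ/8 = σ/4`.

The work is to justify this integration. `weak_balance` tests an equation `∂ₜ e = L e - P` against a
cutoff, up to the initial time; positivity of `P` supplies its integrability. At infinity the cutoff
error is bounded by a multiple of an integrable function, because `v² φ''` is scale invariant. At
the origin the drift does not vanish, `f` need not vanish, and mass may cross from `v < 0`. The term
`√α f` is subtracted for this reason: the gap is zero where `m = 0` and is `O(√m)` nearby, so the
flux of the gap through the origin disappears in the limit.

Zeros of `f` are handled by replacing the first factor `f` with `f + ε m`, which is again a solution
on `v > 0` and is positive there. The regularized productions stay below their limit, so Fatou's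
lemma and dominated convergence together pass to the limit (`integrable_of_tendsto_of_le`). Mass
conservation and nonnegativity of `f` come from the same balance, applied to `f` and to a smoothed
negative part of `f`. -/

/-- The Fokker-Planck operator in nondivergence form, evaluated on the `2`-jet `(e, e', e'')`. -/
noncomputable def fokkerPlanckOp (σ lam v e ev evv : ℝ) : ℝ :=
  σ / 2 * v ^ 2 * evv + (2 * σ * v + lam * (v - 1)) * ev + (σ + lam) * e

/-- The formal adjoint of the Fokker-Planck operator, in terms of the derivatives `φ'`, `φ''`. -/
noncomputable def fokkerPlanckAdj (σ lam : ℝ) (φ' φ'' : ℝ → ℝ) (v : ℝ) : ℝ :=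
  σ / 2 * v ^ 2 * φ'' v - lam * (v - 1) * φ' v

/-- `e` is continuous on `[0, ∞) × s` and of class `C^{1,2}` on `(0, ∞) × s`, with derivatives
`et`, `ev`, `evv`. -/
structure HasParabolicJet (e et ev evv : ℝ → ℝ → ℝ) (s : Set ℝ) : Prop where
  cont : ContinuousOn (fun p : ℝ × ℝ => e p.1 p.2) (Ici 0 ×ˢ s)
  cont_time : ContinuousOn (fun p : ℝ × ℝ => et p.1 p.2) (Ioi 0 ×ˢ s)
  cont_space : ContinuousOn (fun p : ℝ × ℝ => ev p.1 p.2) (Ioi 0 ×ˢ s)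
  cont_space_two : ContinuousOn (fun p : ℝ × ℝ => evv p.1 p.2) (Ioi 0 ×ˢ s)
  time : ∀ t, 0 < t → ∀ v ∈ s, HasDerivAt (fun τ => e τ v) (et t v) t
  space : ∀ t, 0 < t → ∀ v ∈ s, HasDerivAt (e t) (ev t v) v
  space_two : ∀ t, 0 < t → ∀ v ∈ s, HasDerivAt (ev t) (evv t v) v

/-- A nonnegative `C²` function supported in `[a, b]`, with its derivatives. -/
structure IsCutoff (φ φ' φ'' : ℝ → ℝ) (a b : ℝ) : Prop where
  lt : a < b
  nonneg : ∀ v, 0 ≤ φ v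
  deriv_one : ∀ v, HasDerivAt φ (φ' v) v
  deriv_two : ∀ v, HasDerivAt φ' (φ'' v) v
  cont : Continuous φ''
  zero : ∀ v, v ∉ Ioo a b → φ v = 0
  zero_one : ∀ v, v ∉ Ioo a b → φ' v = 0
  zero_two : ∀ v, v ∉ Ioo a b → φ'' v = 0

namespace IsCutoff

variable {φ φ' φ'' : ℝ → ℝ} {a b : ℝ}

lemma continuous (h : IsCutoff φ φ' φ'' a b) : Continuous φ :=
  continuous_iff_continuousAt.2 fun v => (h.deriv_one v).continuousAt

lemma continuous_one (h : IsCutoff φ φ' φ'' a b) : Continuous φ' :=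
  continuous_iff_continuousAt.2 fun v => (h.deriv_two v).continuousAt

lemma continuous_adj (h : IsCutoff φ φ' φ'' a b) (σ lam : ℝ) :
    Continuous (fokkerPlanckAdj σ lam φ' φ'') := by
  have h1 := h.continuous_one
  have h2 := h.cont
  unfold fokkerPlanckAdj
  fun_prop

lemma adj_zero (h : IsCutoff φ φ' φ'' a b) (σ lam : ℝ) {v : ℝ} (hv : v ∉ Ioo a b) :
    fokkerPlanckAdj σ lam φ' φ'' v = 0 := by
  simp [fokkerPlanckAdj, h.zero_one v hv, h.zero_two v hv]

end IsCutoff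

/-! ### Integrals over a compact interval depending on time -/

lemma slice_continuousOn {g : ℝ → ℝ → ℝ} {I s : Set ℝ}
    (hg : ContinuousOn (fun p : ℝ × ℝ => g p.1 p.2) (I ×ˢ s)) {t : ℝ} (ht : t ∈ I) :
    ContinuousOn (g t) s :=
  hg.comp (f := fun v => (t, v)) (by fun_prop) fun _ hv => ⟨ht, hv⟩

lemma continuousOn_parametric_integral {g : ℝ → ℝ → ℝ} {a b T : ℝ} (hab : a ≤ b) (hT : 0 ≤ T)
    (hg : ContinuousOn (fun p : ℝ × ℝ => g p.1 p.2) (Icc 0 T ×ˢ Icc a b)) :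
    ContinuousOn (fun t => ∫ v in a..b, g t v) (Icc 0 T) := by
  let G : ℝ → ℝ → ℝ := fun t v => g (projIcc 0 T hT t) (projIcc a b hab v)
  have hG : Continuous (Function.uncurry G) := by
    refine hg.comp_continuous (f := fun p : ℝ × ℝ =>
      (((projIcc 0 T hT p.1 : ℝ), (projIcc a b hab p.2 : ℝ)) : ℝ × ℝ)) ?_ ?_
    · exact (continuous_subtype_val.comp (continuous_projIcc.comp continuous_fst)).prodMk
        (continuous_subtype_val.comp (continuous_projIcc.comp continuous_snd))
    · intro p
      exact ⟨(projIcc 0 T hT p.1).2, (projIcc a b hab p.2).2⟩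
  have h := intervalIntegral.continuous_parametric_intervalIntegral_of_continuous'
    (μ := volume) hG a b
  refine h.continuousOn.congr fun t ht => ?_
  refine intervalIntegral.integral_congr fun v hv => ?_
  rw [uIcc_of_le hab] at hv
  simp only [G, projIcc_of_mem hT ht, projIcc_of_mem hab hv]

lemma hasDerivAt_parametric_integral {g g' : ℝ → ℝ → ℝ} {a b t : ℝ} (hab : a ≤ b) (ht : 0 < t)
    (hg : ContinuousOn (fun p : ℝ × ℝ => g p.1 p.2) (Ioi 0 ×ˢ Icc a b))
    (hg' : ContinuousOn (fun p : ℝ × ℝ => g' p.1 p.2) (Ioi 0 ×ˢ Icc a b))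
    (hd : ∀ τ, 0 < τ → ∀ v ∈ Icc a b, HasDerivAt (fun τ => g τ v) (g' τ v) τ) :
    HasDerivAt (fun τ => ∫ v in a..b, g τ v) (∫ v in a..b, g' t v) t := by
  have hK : IsCompact (Icc (t / 2) (2 * t) ×ˢ Icc a b) := isCompact_Icc.prod isCompact_Icc
  have hsub : Icc (t / 2) (2 * t) ×ˢ Icc a b ⊆ Ioi 0 ×ˢ Icc a b := by
    rintro ⟨τ, v⟩ ⟨h1, h2⟩
    exact ⟨lt_of_lt_of_le (by positivity) h1.1, h2⟩
  obtain ⟨C, hC⟩ := hK.exists_bound_of_continuousOn (hg'.mono hsub)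
  have hs : Icc (t / 2) (2 * t) ∈ 𝓝 t := Icc_mem_nhds (by linarith) (by linarith)
  have hI : uIoc a b ⊆ Icc a b := by rw [uIoc_of_le hab]; exact Ioc_subset_Icc_self
  have hii : ∀ τ, 0 < τ → IntervalIntegrable (g τ) volume a b := fun τ hτ =>
    ContinuousOn.intervalIntegrable (by rw [uIcc_of_le hab]; exact slice_continuousOn hg hτ)
  have hii' : IntervalIntegrable (g' t) volume a b :=
    ContinuousOn.intervalIntegrable (by rw [uIcc_of_le hab]; exact slice_continuousOn hg' ht)
  refine (intervalIntegral.hasDerivAt_integral_of_dominated_loc_of_deriv_le (F := g) (F' := g')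
    (bound := fun _ => C) hs ?_ (hii t ht) ?_ ?_ (by simp) ?_).2
  · filter_upwards [lt_mem_nhds ht] with τ hτ
    exact (intervalIntegrable_iff.1 (hii τ hτ)).aestronglyMeasurable
  · exact (intervalIntegrable_iff.1 hii').aestronglyMeasurable
  · exact ae_of_all _ fun v hv τ hτ => hC (τ, v) ⟨hτ, hI hv⟩
  · exact ae_of_all _ fun v hv τ hτ => hd τ (lt_of_lt_of_le (by positivity) hτ.1) v (hI hv)

/-! ### The weak balance on a space-time slab -/

/-- Integration by parts against a cutoff function. -/
lemma integral_fokkerPlanckOp_mul {σ lam a b : ℝ} {e ev evv φ φ' φ'' : ℝ → ℝ}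
    (h1 : ∀ v ∈ Icc a b, HasDerivAt e (ev v) v) (h2 : ∀ v ∈ Icc a b, HasDerivAt ev (evv v) v)
    (hc : ContinuousOn evv (Icc a b)) (hφ : IsCutoff φ φ' φ'' a b) :
    ∫ v in a..b, fokkerPlanckOp σ lam v (e v) (ev v) (evv v) * φ v =
      ∫ v in a..b, e v * fokkerPlanckAdj σ lam φ' φ'' v := by
  have hab := hφ.lt.le
  have c0 : ContinuousOn e (Icc a b) := fun v hv => (h1 v hv).continuousAt.continuousWithinAt
  have c1 : ContinuousOn ev (Icc a b) := fun v hv => (h2 v hv).continuousAt.continuousWithinAt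
  have cφ := hφ.continuous
  have cφ' := hφ.continuous_adj σ lam
  have i1 : IntervalIntegrable
      (fun v => fokkerPlanckOp σ lam v (e v) (ev v) (evv v) * φ v) volume a b := by
    apply ContinuousOn.intervalIntegrable
    rw [uIcc_of_le hab]
    unfold fokkerPlanckOp
    fun_prop
  have i2 : IntervalIntegrable
      (fun v => e v * fokkerPlanckAdj σ lam φ' φ'' v) volume a b := by
    apply ContinuousOn.intervalIntegrable
    rw [uIcc_of_le hab]
    fun_prop
  rw [← sub_eq_zero, ← intervalIntegral.integral_sub i1 i2]
  -- Lagrange's identity: this bracket is a primitive of `(L e) φ - e (L* φ)`, and every term of it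
  -- carries `φ` or `φ'`, which vanish at both ends.
  have hJ : ∀ v ∈ uIcc a b, HasDerivAt
      (fun v => σ / 2 * ((2 * v * e v + v ^ 2 * ev v) * φ v - v ^ 2 * e v * φ' v)
        + lam * ((v - 1) * e v * φ v))
      (fokkerPlanckOp σ lam v (e v) (ev v) (evv v) * φ v
        - e v * fokkerPlanckAdj σ lam φ' φ'' v) v := by
    intro v hv
    rw [uIcc_of_le hab] at hv
    have d0 := h1 v hv
    have d1 := h2 v hv
    have p0 := hφ.deriv_one v
    have p1 := hφ.deriv_two v
    have dv := hasDerivAt_id' v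
    have dv2 := hasDerivAt_pow 2 v
    refine HasDerivAt.congr_deriv ((((((((dv.const_mul 2).mul d0).add (dv2.mul d1)).mul p0).sub
      ((dv2.mul d0).mul p1)).const_mul (σ / 2)).add
      ((((dv.sub_const 1).mul d0).mul p0).const_mul lam))) ?_
    simp only [fokkerPlanckOp, fokkerPlanckAdj]
    push_cast
    simp only [Pi.mul_apply, Pi.add_apply]
    ring
  rw [intervalIntegral.integral_eq_sub_of_hasDerivAt hJ (i1.sub i2)]
  have ha : a ∉ Ioo a b := fun h => lt_irrefl _ h.1
  have hb : b ∉ Ioo a b := fun h => lt_irrefl _ h.2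
  simp [hφ.zero a ha, hφ.zero b hb, hφ.zero_one a ha, hφ.zero_one b hb]

/-- Lebesgue measure on the slab `(0, T] × ℝ`. -/
noncomputable abbrev slab (T : ℝ) : Measure (ℝ × ℝ) :=
  (volume.restrict (Ioc 0 T)).prod volume

lemma slab_restrict (T : ℝ) (s : Set ℝ) :
    (slab T).restrict (univ ×ˢ s) = volume.restrict (Ioc 0 T ×ˢ s) := by
  rw [Measure.volume_eq_prod, ← Measure.prod_restrict, ← Measure.prod_restrict,
    Measure.restrict_univ]

/-- On a slab, integrals of functions vanishing off `ℝ × [a, b]` are iterated integrals. -/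
lemma slab_integral_eq {T a b : ℝ} (hT : 0 ≤ T) (hab : a ≤ b) {g : ℝ × ℝ → ℝ}
    (hz : ∀ p : ℝ × ℝ, p.2 ∉ Icc a b → g p = 0)
    (hg : IntegrableOn g (Ioc 0 T ×ˢ Icc a b)) :
    Integrable g (slab T) ∧ ∫ p, g p ∂(slab T) = ∫ t in (0 : ℝ)..T, ∫ v in a..b, g (t, v) := by
  have hz' : ∀ p, p ∉ (univ : Set ℝ) ×ˢ Icc a b → g p = 0 := by
    intro p hp
    exact hz p fun h => hp ⟨trivial, h⟩
  have hg' : IntegrableOn g (univ ×ˢ Icc a b) (slab T) := by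
    rw [IntegrableOn, slab_restrict]; exact hg
  refine ⟨(integrableOn_iff_integrable_of_support_subset ?_).1 hg', ?_⟩
  · intro p hp
    by_contra h
    exact hp (hz' p h)
  · rw [← setIntegral_eq_integral_of_forall_compl_eq_zero hz', slab_restrict,
      Measure.volume_eq_prod, setIntegral_prod _ (by rwa [← Measure.volume_eq_prod]),
      intervalIntegral.integral_of_le hT]
    simp only [intervalIntegral.integral_of_le hab, integral_Icc_eq_integral_Ioc]

lemma slab_integral_continuousOn {T a b : ℝ} (hT : 0 ≤ T) (hab : a ≤ b) {g : ℝ × ℝ → ℝ}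
    (hz : ∀ p : ℝ × ℝ, p.2 ∉ Icc a b → g p = 0)
    (hg : ContinuousOn g (Icc 0 T ×ˢ Icc a b)) :
    Integrable g (slab T) ∧ ∫ p, g p ∂(slab T) = ∫ t in (0 : ℝ)..T, ∫ v in a..b, g (t, v) :=
  slab_integral_eq hT hab hz
    ((hg.integrableOn_compact (isCompact_Icc.prod isCompact_Icc)).mono_set
      (prod_mono Ioc_subset_Icc_self le_rfl))

lemma integral_eq_intervalIntegral_of_zero {a b : ℝ} (hab : a ≤ b) {g : ℝ → ℝ}
    (hz : ∀ v, v ∉ Icc a b → g v = 0) : ∫ v, g v = ∫ v in a..b, g v := by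
  rw [← setIntegral_eq_integral_of_forall_compl_eq_zero hz, intervalIntegral.integral_of_le hab,
    integral_Icc_eq_integral_Ioc]

/-- The weak form of `∂ₜ e = L e - P` with `P ≥ 0`, up to the initial time. -/
theorem weak_balance {σ lam a b T : ℝ} (hT : 0 < T) {e et ev evv : ℝ → ℝ → ℝ} {s : Set ℝ}
    (he : HasParabolicJet e et ev evv s) {φ φ' φ'' : ℝ → ℝ} (hφ : IsCutoff φ φ' φ'' a b)
    (hs : Icc a b ⊆ s) {P : ℝ → ℝ → ℝ} (hP : ∀ t, 0 < t → ∀ v ∈ s, 0 ≤ P t v)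
    (heq : ∀ t, 0 < t → ∀ v ∈ s,
      et t v = fokkerPlanckOp σ lam v (e t v) (ev t v) (evv t v) - P t v) :
    Integrable (fun p : ℝ × ℝ => e p.1 p.2 * fokkerPlanckAdj σ lam φ' φ'' p.2) (slab T) ∧
    Integrable (fun p : ℝ × ℝ => P p.1 p.2 * φ p.2) (slab T) ∧
    ∫ p, P p.1 p.2 * φ p.2 ∂(slab T) = (∫ v, e 0 v * φ v) - (∫ v, e T v * φ v)
      + ∫ p, e p.1 p.2 * fokkerPlanckAdj σ lam φ' φ'' p.2 ∂(slab T) := by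
  have hab := hφ.lt.le
  have cφ := hφ.continuous
  have cA := hφ.continuous_adj σ lam
  have zφ : ∀ v, v ∉ Icc a b → φ v = 0 := fun v hv => hφ.zero v fun h => hv (Ioo_subset_Icc_self h)
  have zA : ∀ v, v ∉ Icc a b → fokkerPlanckAdj σ lam φ' φ'' v = 0 :=
    fun v hv => hφ.adj_zero σ lam fun h => hv (Ioo_subset_Icc_self h)
  have sub0 : Icc 0 T ×ˢ Icc a b ⊆ Ici 0 ×ˢ s := prod_mono Icc_subset_Ici_self hs
  have sub1 : Ioi (0 : ℝ) ×ˢ Icc a b ⊆ Ioi 0 ×ˢ s := prod_mono le_rfl hs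
  have sub2 : Ioi (0 : ℝ) ×ˢ Icc a b ⊆ Ici 0 ×ˢ s := prod_mono Ioi_subset_Ici_self hs
  have c0 := he.cont.mono sub0
  have c0' := he.cont.mono sub2
  have ct := he.cont_time.mono sub1
  have c1 := he.cont_space.mono sub1
  have c2 := he.cont_space_two.mono sub1
  -- Continuity of `P` at positive times is not assumed; the equation expresses `P` through the jet
  -- of `e`.
  have hPc : ContinuousOn (fun p : ℝ × ℝ => P p.1 p.2) (Ioi 0 ×ˢ Icc a b) := by
    have : ContinuousOn (fun p : ℝ × ℝ => fokkerPlanckOp σ lam p.2 (e p.1 p.2) (ev p.1 p.2)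
        (evv p.1 p.2) - et p.1 p.2) (Ioi 0 ×ˢ Icc a b) := by
      unfold fokkerPlanckOp
      fun_prop
    refine this.congr fun p hp => ?_
    have := heq p.1 hp.1 p.2 (hs hp.2)
    simp only; linarith
  have hPφc : ContinuousOn (fun p : ℝ × ℝ => P p.1 p.2 * φ p.2) (Ioi 0 ×ˢ Icc a b) := by fun_prop
  obtain ⟨iA, eA⟩ := slab_integral_continuousOn hT.le hab
    (g := fun p : ℝ × ℝ => e p.1 p.2 * fokkerPlanckAdj σ lam φ' φ'' p.2)
    (fun p hp => by simp [zA p.2 hp]) (by fun_prop)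
  set Q : ℝ → ℝ := fun t => ∫ v in a..b, e t v * fokkerPlanckAdj σ lam φ' φ'' v with hQ
  set m : ℝ → ℝ := fun t => ∫ v in a..b, e t v * φ v with hm
  set F : ℝ → ℝ := fun t => ∫ v in a..b, P t v * φ v with hF
  have hQc : ContinuousOn Q (Icc 0 T) := continuousOn_parametric_integral hab hT.le (by fun_prop)
  have hmc : ContinuousOn m (Icc 0 T) := continuousOn_parametric_integral hab hT.le (by fun_prop)
  have hmd : ∀ t, 0 < t → HasDerivAt m (Q t - F t) t := by
    intro t ht
    have h := hasDerivAt_parametric_integral (g := fun t v => e t v * φ v)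
      (g' := fun t v => et t v * φ v) hab ht (by fun_prop) (by fun_prop)
      (fun τ hτ v hv => (he.time τ hτ v (hs hv)).mul_const _)
    refine h.congr_deriv ?_
    have hibp := integral_fokkerPlanckOp_mul (σ := σ) (lam := lam)
      (fun v hv => he.space t ht v (hs hv)) (fun v hv => he.space_two t ht v (hs hv))
      (slice_continuousOn c2 ht) hφ
    change _ = (∫ v in a..b, e t v * fokkerPlanckAdj σ lam φ' φ'' v) - ∫ v in a..b, P t v * φ v
    rw [← hibp, ← intervalIntegral.integral_sub]
    · refine intervalIntegral.integral_congr fun v hv => ?_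
      rw [uIcc_of_le hab] at hv
      rw [heq t ht v (hs hv)]
      ring
    · apply ContinuousOn.intervalIntegrable
      rw [uIcc_of_le hab]
      have k0 := slice_continuousOn c0' (mem_Ioi.2 ht)
      have k1 := slice_continuousOn c1 (mem_Ioi.2 ht)
      have k2 := slice_continuousOn c2 (mem_Ioi.2 ht)
      unfold fokkerPlanckOp
      fun_prop
    · apply ContinuousOn.intervalIntegrable
      rw [uIcc_of_le hab]
      have k0 := slice_continuousOn hPc (mem_Ioi.2 ht)
      fun_prop
  have hFn : ∀ t, 0 < t → 0 ≤ F t := by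
    intro t ht
    refine intervalIntegral.integral_nonneg hab fun v hv => ?_
    exact mul_nonneg (hP t ht v (hs hv)) (hφ.nonneg v)
  have hQi : ∀ t ∈ Icc 0 T, IntervalIntegrable Q volume 0 t := by
    intro t ht
    apply ContinuousOn.intervalIntegrable
    rw [uIcc_of_le ht.1]
    exact hQc.mono (Icc_subset_Icc_right ht.2)
  -- The derivatives of `e` are not controlled as `t → 0`, so `F` might blow up there. But `F ≥ 0`
  -- is the derivative on `(0, T)` of `G`, which is continuous on all of `[0, T]`; a nonnegative
  -- derivative of such a function is integrable, and the fundamental theorem holds up to `0`.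
  set G : ℝ → ℝ := fun t => (∫ τ in (0 : ℝ)..t, Q τ) - m t with hG
  have hGc : ContinuousOn G (Icc 0 T) := by
    refine ContinuousOn.sub ?_ hmc
    have := intervalIntegral.continuousOn_primitive_interval (f := Q) (a := 0) (b := T)
      (μ := volume) (by rw [uIcc_of_le hT.le]; exact hQc.integrableOn_Icc)
    rwa [uIcc_of_le hT.le] at this
  have hGd : ∀ t ∈ Ioo 0 T, HasDerivAt G (F t) t := by
    intro t ht
    have hQt : ContinuousAt Q t := hQc.continuousAt (Icc_mem_nhds ht.1 ht.2)
    have h1 := intervalIntegral.integral_hasDerivAt_right (hQi t ⟨ht.1.le, ht.2.le⟩)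
      (hQc.mono Ioo_subset_Icc_self |>.stronglyMeasurableAtFilter isOpen_Ioo t ht) hQt
    refine (h1.sub (hmd t ht.1)).congr_deriv ?_
    ring
  have hFi : IntegrableOn F (Ioc 0 T) :=
    intervalIntegral.integrableOn_deriv_of_nonneg hGc hGd fun t ht => hFn t ht.1
  have hFint : ∫ t in (0 : ℝ)..T, F t = G T - G 0 :=
    intervalIntegral.integral_eq_sub_of_hasDerivAt_of_le hT.le hGc hGd
      ((intervalIntegrable_iff_integrableOn_Ioc_of_le hT.le).2 hFi)
  have hPi : IntegrableOn (fun p : ℝ × ℝ => P p.1 p.2 * φ p.2) (Ioc 0 T ×ˢ Icc a b) := by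
    have hmeas : AEStronglyMeasurable (fun p : ℝ × ℝ => P p.1 p.2 * φ p.2)
        (volume.restrict (Ioc 0 T ×ˢ Icc a b)) :=
      (hPφc.mono (prod_mono Ioc_subset_Ioi_self le_rfl)).aestronglyMeasurable
        (measurableSet_Ioc.prod measurableSet_Icc)
    rw [IntegrableOn, Measure.volume_eq_prod, ← Measure.prod_restrict] at *
    rw [integrable_prod_iff hmeas]
    constructor
    · filter_upwards [ae_restrict_mem measurableSet_Ioc] with t ht
      exact (slice_continuousOn (g := fun t v => P t v * φ v) hPφc ht.1).integrableOn_Icc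
    -- By positivity the norm of a section integrates to `F t`, whose integrability is already
    -- known.
    · refine Integrable.congr hFi ?_
      filter_upwards [ae_restrict_mem measurableSet_Ioc] with t ht
      rw [hF]
      simp only
      rw [intervalIntegral.integral_of_le hab, ← integral_Icc_eq_integral_Ioc]
      refine setIntegral_congr_fun measurableSet_Icc fun v hv => ?_
      exact (Real.norm_of_nonneg (mul_nonneg (hP t ht.1 v (hs hv)) (hφ.nonneg v))).symm
  obtain ⟨iP, eP⟩ := slab_integral_eq hT.le hab (fun p hp => by simp [zφ p.2 hp]) hPi
  refine ⟨iA, iP, ?_⟩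
  rw [eP, eA, integral_eq_intervalIntegral_of_zero hab (fun v hv => by simp [zφ v hv]),
    integral_eq_intervalIntegral_of_zero hab (fun v hv => by simp [zφ v hv])]
  change ∫ t in (0 : ℝ)..T, F t = m 0 - m T + ∫ t in (0 : ℝ)..T, Q t
  rw [hFint, hG]
  simp only [intervalIntegral.integral_same]
  ring

/-! ### Cutoff functions -/

/-- One-sided uniqueness of the derivative covers boundary points of `s`; this makes the derivatives
of the step vanish at `0` and `1` too. -/
lemma hasDerivAt_zero_of_eqOn {g : ℝ → ℝ} {d c x : ℝ} {s : Set ℝ} (hd : HasDerivAt g d x)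
    (hs : UniqueDiffWithinAt ℝ s x) (hx : x ∈ s) (h : ∀ y ∈ s, g y = c) : d = 0 := by
  have h1 := hd.hasDerivWithinAt (s := s)
  have h2 : HasDerivWithinAt g 0 s x :=
    (hasDerivWithinAt_const x s c).congr h (h x hx)
  exact hs.eq_deriv s h1 h2

/-- First derivative of the smooth step. -/
noncomputable def stepDeriv : ℝ → ℝ := deriv Real.smoothTransition

/-- Second derivative of the smooth step. -/
noncomputable def stepDerivTwo : ℝ → ℝ := deriv stepDeriv

lemma contDiff_stepDeriv : ContDiff ℝ ∞ stepDeriv := by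
  have h : ContDiff ℝ (∞ + 1) Real.smoothTransition := Real.smoothTransition.contDiff (n := ⊤)
  exact ((contDiff_succ_iff_deriv).1 h).2.2

lemma contDiff_stepDerivTwo : ContDiff ℝ ∞ stepDerivTwo := by
  have h : ContDiff ℝ (∞ + 1) stepDeriv := contDiff_stepDeriv
  exact ((contDiff_succ_iff_deriv).1 h).2.2

lemma hasDerivAt_step (x : ℝ) : HasDerivAt Real.smoothTransition (stepDeriv x) x :=
  ((Real.smoothTransition.contDiff (n := 1)).differentiable (by simp) x).hasDerivAt

lemma hasDerivAt_stepDeriv (x : ℝ) : HasDerivAt stepDeriv (stepDerivTwo x) x :=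
  (contDiff_stepDeriv.differentiable (by simp) x).hasDerivAt

lemma stepDeriv_eq_zero {x : ℝ} (hx : x ∉ Ioo (0 : ℝ) 1) : stepDeriv x = 0 := by
  rcases le_or_gt x 0 with h | h
  · exact hasDerivAt_zero_of_eqOn (hasDerivAt_step x) (uniqueDiffOn_Iic 0 x h) h
      fun y hy => Real.smoothTransition.zero_of_nonpos hy
  · have h1 : (1 : ℝ) ≤ x := not_lt.1 fun h' => hx ⟨h, h'⟩
    exact hasDerivAt_zero_of_eqOn (hasDerivAt_step x) (uniqueDiffOn_Ici 1 x h1) h1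
      fun y hy => Real.smoothTransition.one_of_one_le hy

lemma stepDerivTwo_eq_zero {x : ℝ} (hx : x ∉ Ioo (0 : ℝ) 1) : stepDerivTwo x = 0 := by
  rcases le_or_gt x 0 with h | h
  · exact hasDerivAt_zero_of_eqOn (hasDerivAt_stepDeriv x) (uniqueDiffOn_Iic 0 x h) h
      fun y hy => stepDeriv_eq_zero fun h' => not_lt.2 hy h'.1
  · have h1 : (1 : ℝ) ≤ x := not_lt.1 fun h' => hx ⟨h, h'⟩
    exact hasDerivAt_zero_of_eqOn (hasDerivAt_stepDeriv x) (uniqueDiffOn_Ici 1 x h1) h1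
      fun y hy => stepDeriv_eq_zero fun h' => not_lt.2 hy h'.2

/-- The scaled step `v ↦ S (c v - 1)`. -/
noncomputable def scaledStep (c v : ℝ) : ℝ := Real.smoothTransition (c * v - 1)

/-- First derivative of `scaledStep`. -/
noncomputable def scaledStepDeriv (c v : ℝ) : ℝ := c * stepDeriv (c * v - 1)

/-- Second derivative of `scaledStep`. -/
noncomputable def scaledStepDerivTwo (c v : ℝ) : ℝ := c ^ 2 * stepDerivTwo (c * v - 1)

lemma hasDerivAt_scaledStep (c v : ℝ) : HasDerivAt (scaledStep c) (scaledStepDeriv c v) v := by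
  have h := (hasDerivAt_step (c * v - 1)).comp v (((hasDerivAt_id' v).const_mul c).sub_const 1)
  exact h.congr_deriv (by rw [scaledStepDeriv]; ring)

lemma hasDerivAt_scaledStepDeriv (c v : ℝ) :
    HasDerivAt (scaledStepDeriv c) (scaledStepDerivTwo c v) v := by
  have h := ((hasDerivAt_stepDeriv (c * v - 1)).comp v
    (((hasDerivAt_id' v).const_mul c).sub_const 1)).const_mul c
  exact h.congr_deriv (by rw [scaledStepDerivTwo]; ring)

lemma continuous_scaledStepDerivTwo (c : ℝ) : Continuous (scaledStepDerivTwo c) := by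
  have := contDiff_stepDerivTwo.continuous
  unfold scaledStepDerivTwo
  fun_prop

lemma scaledStep_eq_zero {c v : ℝ} (h : c * v ≤ 1) : scaledStep c v = 0 :=
  Real.smoothTransition.zero_of_nonpos (by linarith)

lemma scaledStep_eq_one {c v : ℝ} (h : 2 ≤ c * v) : scaledStep c v = 1 :=
  Real.smoothTransition.one_of_one_le (by linarith)

lemma scaledStepDeriv_eq_zero {c v : ℝ} (h : c * v ∉ Ioo (1 : ℝ) 2) : scaledStepDeriv c v = 0 := by
  rw [scaledStepDeriv, stepDeriv_eq_zero, mul_zero]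
  exact fun h' => h ⟨by linarith [h'.1], by linarith [h'.2]⟩

lemma scaledStepDerivTwo_eq_zero {c v : ℝ} (h : c * v ∉ Ioo (1 : ℝ) 2) :
    scaledStepDerivTwo c v = 0 := by
  rw [scaledStepDerivTwo, stepDerivTwo_eq_zero, mul_zero]
  exact fun h' => h ⟨by linarith [h'.1], by linarith [h'.2]⟩

/-- The adjoint operator applied to the scaled step. -/
noncomputable def stepAdj (σ lam c v : ℝ) : ℝ :=
  fokkerPlanckAdj σ lam (scaledStepDeriv c) (scaledStepDerivTwo c) v

lemma stepAdj_eq_zero (σ lam : ℝ) {c v : ℝ} (h : c * v ∉ Ioo (1 : ℝ) 2) :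
    stepAdj σ lam c v = 0 := by
  simp [stepAdj, fokkerPlanckAdj, scaledStepDeriv_eq_zero h, scaledStepDerivTwo_eq_zero h]

lemma continuous_stepAdj (σ lam c : ℝ) : Continuous (stepAdj σ lam c) := by
  have h1 : Continuous (scaledStepDeriv c) :=
    continuous_iff_continuousAt.2 fun v => (hasDerivAt_scaledStepDeriv c v).continuousAt
  have h2 := continuous_scaledStepDerivTwo c
  unfold stepAdj fokkerPlanckAdj
  fun_prop

lemma exists_bound_of_zero {g : ℝ → ℝ} (hg : Continuous g) (h : ∀ x, x ∉ Ioo (0 : ℝ) 1 → g x = 0) :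
    ∃ C, 0 ≤ C ∧ ∀ x, |g x| ≤ C := by
  obtain ⟨C, hC⟩ := (isCompact_Icc (a := (0 : ℝ)) (b := 1)).exists_bound_of_continuousOn
    hg.continuousOn
  refine ⟨C, (norm_nonneg _).trans (hC 0 (by simp)), fun x => ?_⟩
  by_cases hx : x ∈ Icc (0 : ℝ) 1
  · exact hC x hx
  · rw [h x fun h' => hx (Ioo_subset_Icc_self h'), abs_zero]
    exact (norm_nonneg _).trans (hC 0 (by simp))

/-- In the variable `c v`, confined to `(1, 2)`, the diffusion part `v² φ''` does not depend on `c`,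
and neither does `v φ'`. Only the constant part of the drift `v - 1` produces a factor `c`. Hence
the bound is uniform for cutoffs at infinity (`c = ±1/n`) and of order `n` at the origin (`c = n`).
-/
lemma stepAdj_bound (σ lam : ℝ) : ∃ C, 0 ≤ C ∧ ∀ c v, |stepAdj σ lam c v| ≤ C * (1 + |c|) := by
  obtain ⟨C1, h1, hC1⟩ := exists_bound_of_zero contDiff_stepDeriv.continuous
    fun x hx => stepDeriv_eq_zero hx
  obtain ⟨C2, h2, hC2⟩ := exists_bound_of_zero contDiff_stepDerivTwo.continuous
    fun x hx => stepDerivTwo_eq_zero hx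
  refine ⟨2 * |σ| * C2 + 2 * |lam| * C1, by positivity, fun c v => ?_⟩
  by_cases h : c * v ∈ Ioo (1 : ℝ) 2
  · have e : stepAdj σ lam c v = σ / 2 * (c * v) ^ 2 * stepDerivTwo (c * v - 1)
        - lam * (c * v - c) * stepDeriv (c * v - 1) := by
      simp only [stepAdj, fokkerPlanckAdj, scaledStepDeriv, scaledStepDerivTwo]; ring
    rw [e]
    refine (abs_sub _ _).trans ?_
    simp only [abs_mul, abs_pow, abs_div]
    have hcv : |c * v| ≤ 2 := abs_le.2 ⟨by linarith [h.1], h.2.le⟩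
    have hcv' : |c * v - c| ≤ 2 * (1 + |c|) := by
      refine (abs_sub _ _).trans ?_
      linarith [abs_nonneg c]
    rw [abs_mul] at hcv
    have hsq : (|c| * |v|) ^ 2 ≤ 2 ^ 2 := pow_le_pow_left₀ (by positivity) hcv 2
    calc |σ| / |2| * (|c| * |v|) ^ 2 * |stepDerivTwo (c * v - 1)|
          + |lam| * |c * v - c| * |stepDeriv (c * v - 1)|
        ≤ |σ| / 2 * 2 ^ 2 * C2 + |lam| * (2 * (1 + |c|)) * C1 := by
          rw [abs_two]
          gcongr
          · exact hC2 _
          · exact hC1 _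
      _ ≤ (2 * |σ| * C2 + 2 * |lam| * C1) * (1 + |c|) := by
          have : 0 ≤ |σ| * C2 * |c| := by positivity
          nlinarith
  · rw [stepAdj_eq_zero σ lam h, abs_zero]
    positivity

/-- The cutoff at infinity `θₙ`, for `n ≥ 1`, equal to one on `[-n, n]`. -/
noncomputable def outerCutoff (n v : ℝ) : ℝ := 1 - scaledStep n⁻¹ v - scaledStep (-n⁻¹) v

/-- The cutoff on the half-line, equal to one on `[2 / n, n]`. -/
noncomputable def innerCutoff (n v : ℝ) : ℝ := scaledStep n v - scaledStep n⁻¹ v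

lemma scaledStep_nonneg (c v : ℝ) : 0 ≤ scaledStep c v := Real.smoothTransition.nonneg _

lemma scaledStep_le_one (c v : ℝ) : scaledStep c v ≤ 1 := Real.smoothTransition.le_one _

lemma outerCutoff_mem {n : ℝ} (hn : 0 < n) (v : ℝ) :
    outerCutoff n v ∈ Icc (0 : ℝ) 1 := by
  have h1 := scaledStep_nonneg n⁻¹ v
  have h2 := scaledStep_nonneg (-n⁻¹) v
  have h3 := scaledStep_le_one n⁻¹ v
  have h4 := scaledStep_le_one (-n⁻¹) v
  have hn' := inv_pos.2 hn
  rw [outerCutoff]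
  rcases le_total v 0 with h | h
  · rw [scaledStep_eq_zero (c := n⁻¹) (by nlinarith)]
    constructor <;> linarith
  · rw [scaledStep_eq_zero (c := -n⁻¹) (by nlinarith)]
    constructor <;> linarith

lemma outerCutoff_eq_one {n v : ℝ} (hn : 0 < n) (hv : |v| ≤ n) : outerCutoff n v = 1 := by
  have h := abs_le.1 hv
  rw [outerCutoff, scaledStep_eq_zero, scaledStep_eq_zero]
  · ring
  · rw [neg_mul, inv_mul_eq_div, ← neg_div, div_le_one hn]; linarith
  · rw [inv_mul_eq_div, div_le_one hn]; linarith

lemma isCutoff_outer {n : ℝ} (hn : 0 < n) :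
    IsCutoff (outerCutoff n) (fun v => -scaledStepDeriv n⁻¹ v - scaledStepDeriv (-n⁻¹) v)
      (fun v => -scaledStepDerivTwo n⁻¹ v - scaledStepDerivTwo (-n⁻¹) v) (-(2 * n)) (2 * n) := by
  have key : ∀ v, v ∉ Ioo (-(2 * n)) (2 * n) →
      (2 ≤ n⁻¹ * v ∧ -n⁻¹ * v ≤ 1) ∨ (n⁻¹ * v ≤ 1 ∧ 2 ≤ -n⁻¹ * v) := by
    intro v hv
    rw [neg_mul, inv_mul_eq_div, ← neg_div, le_div_iff₀ hn, le_div_iff₀ hn, div_le_one hn,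
      div_le_one hn]
    by_cases h : 2 * n ≤ v
    · left; constructor <;> linarith
    · right
      have : v ≤ -(2 * n) := not_lt.1 fun h' => hv ⟨h', not_le.1 h⟩
      constructor <;> linarith
  refine ⟨by linarith, fun v => (outerCutoff_mem hn v).1, fun v => ?_, fun v => ?_, ?_, ?_, ?_, ?_⟩
  · refine HasDerivAt.congr_deriv (((hasDerivAt_const v (1 : ℝ)).sub
      (hasDerivAt_scaledStep n⁻¹ v)).sub (hasDerivAt_scaledStep (-n⁻¹) v)) (by ring)
  · exact (hasDerivAt_scaledStepDeriv n⁻¹ v).neg.sub (hasDerivAt_scaledStepDeriv (-n⁻¹) v)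
  · exact (continuous_scaledStepDerivTwo _).neg.sub (continuous_scaledStepDerivTwo _)
  · intro v hv
    rw [outerCutoff]
    rcases key v hv with h | h
    · rw [scaledStep_eq_one h.1, scaledStep_eq_zero h.2]; ring
    · rw [scaledStep_eq_zero h.1, scaledStep_eq_one h.2]; ring
  · intro v hv
    rw [scaledStepDeriv_eq_zero, scaledStepDeriv_eq_zero]
    · ring
    all_goals
      rintro ⟨h1, h2⟩
      rcases key v hv with h | h <;> linarith [h.1, h.2]
  · intro v hv
    rw [scaledStepDerivTwo_eq_zero, scaledStepDerivTwo_eq_zero]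
    · ring
    all_goals
      rintro ⟨h1, h2⟩
      rcases key v hv with h | h <;> linarith [h.1, h.2]

lemma outer_adj_eq (σ lam n v : ℝ) :
    fokkerPlanckAdj σ lam (fun v => -scaledStepDeriv n⁻¹ v - scaledStepDeriv (-n⁻¹) v)
      (fun v => -scaledStepDerivTwo n⁻¹ v - scaledStepDerivTwo (-n⁻¹) v) v =
      -stepAdj σ lam n⁻¹ v - stepAdj σ lam (-n⁻¹) v := by
  simp only [stepAdj, fokkerPlanckAdj]; ring

lemma innerCutoff_eq_zero {n v : ℝ} (hn : 1 ≤ n) (hv : v ∉ Ioo n⁻¹ (2 * n)) :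
    innerCutoff n v = 0 := by
  have hn0 : 0 < n := by linarith
  rw [innerCutoff]
  by_cases h : v ≤ n⁻¹
  · have h1 : n * v ≤ 1 := by
      have := mul_le_mul_of_nonneg_left h hn0.le
      rwa [mul_inv_cancel₀ hn0.ne'] at this
    have h2 : n⁻¹ * v ≤ 1 := by
      rw [inv_mul_eq_div, div_le_one hn0]
      exact (h.trans (inv_le_one_of_one_le₀ hn)).trans hn
    rw [scaledStep_eq_zero h1, scaledStep_eq_zero h2, sub_zero]
  · have h3 : 2 * n ≤ v := not_lt.1 fun h' => hv ⟨not_le.1 h, h'⟩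
    rw [scaledStep_eq_one, scaledStep_eq_one, sub_self]
    · rw [inv_mul_eq_div, le_div_iff₀ hn0]; exact h3
    · nlinarith

lemma innerCutoff_mem {n : ℝ} (hn : 1 ≤ n) (v : ℝ) : innerCutoff n v ∈ Icc (0 : ℝ) 1 := by
  by_cases hv : v ∈ Ioo n⁻¹ (2 * n)
  · have hn0 : 0 < n := by linarith
    have hv0 : 0 < v := (inv_pos.2 hn0).trans hv.1
    have hnn : n⁻¹ ≤ n := (inv_le_one_of_one_le₀ hn).trans hn
    have h := Real.smoothTransition.monotone
      (sub_le_sub_right (mul_le_mul_of_nonneg_right hnn hv0.le) 1)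
    have h1 := scaledStep_le_one n v
    have h2 := scaledStep_nonneg n⁻¹ v
    rw [innerCutoff]
    constructor
    · simpa [scaledStep] using h
    · linarith
  · rw [innerCutoff_eq_zero hn hv]; simp

lemma innerCutoff_eq_one {n v : ℝ} (hn : 0 < n) (h1 : 2 ≤ n * v) (h2 : v ≤ n) :
    innerCutoff n v = 1 := by
  rw [innerCutoff, scaledStep_eq_one h1, scaledStep_eq_zero, sub_zero]
  rwa [inv_mul_eq_div, div_le_one hn]

lemma isCutoff_inner {n : ℝ} (hn : 2 ≤ n) :
    IsCutoff (innerCutoff n) (fun v => scaledStepDeriv n v - scaledStepDeriv n⁻¹ v)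
      (fun v => scaledStepDerivTwo n v - scaledStepDerivTwo n⁻¹ v) n⁻¹ (2 * n) := by
  have hn0 : 0 < n := by linarith
  have hn1 : n⁻¹ ≤ 1 := inv_le_one_of_one_le₀ (by linarith)
  have key : ∀ v, v ∉ Ioo n⁻¹ (2 * n) →
      n * v ∉ Ioo (1 : ℝ) 2 ∧ n⁻¹ * v ∉ Ioo (1 : ℝ) 2 := by
    intro v hv
    rw [inv_mul_eq_div]
    constructor
    · rintro ⟨h1, h2⟩
      refine hv ⟨?_, by nlinarith⟩
      rw [inv_eq_one_div, div_lt_iff₀ hn0]; linarith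
    · rintro ⟨h1, h2⟩
      rw [lt_div_iff₀ hn0] at h1
      rw [div_lt_iff₀ hn0] at h2
      exact hv ⟨by linarith, h2⟩
  refine ⟨by linarith, fun v => (innerCutoff_mem (by linarith) v).1, fun v => ?_, fun v => ?_, ?_,
    fun v hv => innerCutoff_eq_zero (by linarith) hv, ?_, ?_⟩
  · exact (hasDerivAt_scaledStep n v).sub (hasDerivAt_scaledStep n⁻¹ v)
  · exact (hasDerivAt_scaledStepDeriv n v).sub (hasDerivAt_scaledStepDeriv n⁻¹ v)
  · exact (continuous_scaledStepDerivTwo _).sub (continuous_scaledStepDerivTwo _)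
  · intro v hv
    rw [scaledStepDeriv_eq_zero (key v hv).1, scaledStepDeriv_eq_zero (key v hv).2, sub_zero]
  · intro v hv
    rw [scaledStepDerivTwo_eq_zero (key v hv).1, scaledStepDerivTwo_eq_zero (key v hv).2, sub_zero]

lemma inner_adj_eq (σ lam n v : ℝ) :
    fokkerPlanckAdj σ lam (fun v => scaledStepDeriv n v - scaledStepDeriv n⁻¹ v)
      (fun v => scaledStepDerivTwo n v - scaledStepDerivTwo n⁻¹ v) v =
      stepAdj σ lam n v - stepAdj σ lam n⁻¹ v := by
  simp only [stepAdj, fokkerPlanckAdj]; ring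

lemma stepAdj_tail_eq_zero (σ lam : ℝ) {c v : ℝ} (h : |c| * |v| ≤ 1) : stepAdj σ lam c v = 0 :=
  stepAdj_eq_zero σ lam fun h' => by
    rw [← abs_mul] at h
    linarith [le_abs_self (c * v), h'.1]

/-- Terms carrying derivatives of a cutoff at infinity vanish in the limit. -/
lemma tendsto_slab_integral_tail {T : ℝ} {g : ℕ → ℝ × ℝ → ℝ} {H : ℝ × ℝ → ℝ} {B : ℕ → ℝ → ℝ}
    {C : ℝ} (hm : ∀ n, AEStronglyMeasurable (fun p => g n p * B n p.2) (slab T))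
    (hH : Integrable H (slab T)) (hC : 0 ≤ C)
    (hg : ∀ᶠ n in atTop, ∀ᵐ p ∂(slab T), B n p.2 ≠ 0 → |g n p| ≤ H p)
    (hB : ∀ᶠ n in atTop, ∀ v, |B n v| ≤ C)
    (hz : ∀ v, ∀ᶠ n in atTop, B n v = 0) :
    Tendsto (fun n => ∫ p, g n p * B n p.2 ∂(slab T)) atTop (𝓝 0) := by
  have h := tendsto_integral_filter_of_dominated_convergence (μ := slab T) (l := atTop)
    (F := fun n p => g n p * B n p.2) (f := fun _ => 0) (fun p => C * |H p|)
    (Eventually.of_forall hm) ?_ (hH.abs.const_mul C) ?_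
  · simpa using h
  · filter_upwards [hg, hB] with n hn hB
    filter_upwards [hn] with p hp
    rw [norm_mul, mul_comm]
    by_cases h0 : B n p.2 = 0
    · rw [h0, norm_zero, zero_mul]; positivity
    · exact mul_le_mul (hB p.2) ((hp h0).trans (le_abs_self _)) (abs_nonneg _) hC
  · refine ae_of_all _ fun p => ?_
    refine tendsto_const_nhds.congr' ?_
    filter_upwards [hz p.2] with n hn
    rw [hn, mul_zero]

/-! ### Positivity and conservation of mass -/

lemma aestronglyMeasurable_slab {g : ℝ × ℝ → ℝ} {T : ℝ}
    (hg : ContinuousOn g (Ioi 0 ×ˢ univ)) : AEStronglyMeasurable g (slab T) := by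
  have h := slab_restrict T univ
  rw [univ_prod_univ, Measure.restrict_univ] at h
  rw [h]
  exact (hg.mono (prod_mono Ioc_subset_Ioi_self le_rfl)).aestronglyMeasurable
    (measurableSet_Ioc.prod MeasurableSet.univ)

lemma ae_slab_pos (T : ℝ) : ∀ᵐ p ∂(slab T), p.1 ∈ Ioc 0 T := by
  have h := slab_restrict T univ
  rw [univ_prod_univ, Measure.restrict_univ] at h
  rw [h]
  filter_upwards [ae_restrict_mem (measurableSet_Ioc.prod MeasurableSet.univ)] with p hp
  exact hp.1

lemma integrable_slab_of_bounded {g : ℝ → ℝ → ℝ} {T C : ℝ}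
    (hc : ContinuousOn (fun p : ℝ × ℝ => g p.1 p.2) (Ioi 0 ×ˢ univ))
    (hi : ∀ t ∈ Ioc 0 T, Integrable (g t)) (hb : ∀ t ∈ Ioc 0 T, ∫ v, |g t v| ≤ C) :
    Integrable (fun p : ℝ × ℝ => g p.1 p.2) (slab T) := by
  have hm := aestronglyMeasurable_slab (T := T) hc
  rw [integrable_prod_iff hm]
  constructor
  · filter_upwards [ae_restrict_mem measurableSet_Ioc] with t ht using hi t ht
  · refine Integrable.of_bound (C := C) hm.norm.integral_prod_right' ?_
    filter_upwards [ae_restrict_mem measurableSet_Ioc] with t ht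
    rw [Real.norm_of_nonneg (integral_nonneg fun v => norm_nonneg _)]
    exact hb t ht

lemma integrable_slab_snd {g : ℝ → ℝ} (hg : Integrable g) (T : ℝ) :
    Integrable (fun p : ℝ × ℝ => g p.2) (slab T) :=
  hg.comp_snd _

namespace IsFokkerPlanckSolution

variable {σ lam : ℝ} {f₀ : ℝ → ℝ} {f : ℝ → ℝ → ℝ}

lemma differentiable (hf : IsFokkerPlanckSolution σ lam f₀ f) {t : ℝ} (ht : 0 < t) (v : ℝ) :
    HasDerivAt (f t) (deriv (f t) v) v :=
  (((hf.contDiff_space t ht).differentiable (by simp)) v).hasDerivAt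

lemma differentiable_deriv (hf : IsFokkerPlanckSolution σ lam f₀ f) {t : ℝ} (ht : 0 < t) (v : ℝ) :
    HasDerivAt (deriv (f t)) (deriv (deriv (f t)) v) v := by
  have h : ContDiff ℝ (1 + 1) (f t) := hf.contDiff_space t ht
  exact (((contDiff_succ_iff_deriv.1 h).2.2.differentiable (by simp)) v).hasDerivAt

lemma hasParabolicJet (hf : IsFokkerPlanckSolution σ lam f₀ f) :
    HasParabolicJet f (fun t v => deriv (fun s => f s v) t) (fun t => deriv (f t))
      (fun t => deriv (deriv (f t))) univ where
  cont := hf.continuousOn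
  cont_time := hf.continuousOn_deriv_time
  cont_space := hf.continuousOn_deriv_space
  cont_space_two := by
    have h := hf.continuousOn_deriv_two_space
    simpa only [iteratedDeriv_succ, iteratedDeriv_zero] using h
  time t ht v _ := (hf.differentiable_time t ht v).hasDerivAt
  space t ht v _ := hf.differentiable ht v
  space_two t ht v _ := hf.differentiable_deriv ht v

lemma deriv_time_eq (hf : IsFokkerPlanckSolution σ lam f₀ f) {t : ℝ} (ht : 0 < t) (v : ℝ) :
    deriv (fun s => f s v) t =
      fokkerPlanckOp σ lam v (f t v) (deriv (f t) v) (deriv (deriv (f t)) v) := by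
  rw [hf.equation t ht v]
  have h1 : deriv (fun w => w ^ 2 * f t w) = fun w => 2 * w * f t w + w ^ 2 * deriv (f t) w := by
    funext w
    refine (((hasDerivAt_pow 2 w).mul (hf.differentiable ht w)).congr_deriv ?_).deriv
    push_cast
    ring
  have h2 : deriv (fun w => (w - 1) * f t w) v = f t v + (v - 1) * deriv (f t) v := by
    refine ((((hasDerivAt_id' v).sub_const 1).mul (hf.differentiable ht v)).congr_deriv ?_).deriv
    ring
  have h3 : deriv (fun w => 2 * w * f t w + w ^ 2 * deriv (f t) w) v =
      2 * f t v + 4 * v * deriv (f t) v + v ^ 2 * deriv (deriv (f t)) v := by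
    refine (((((hasDerivAt_id' v).const_mul 2).mul (hf.differentiable ht v)).add
      ((hasDerivAt_pow 2 v).mul (hf.differentiable_deriv ht v))).congr_deriv ?_).deriv
    push_cast
    ring
  rw [iteratedDeriv_succ, iteratedDeriv_one, h1, h2, h3, fokkerPlanckOp]
  ring

lemma integrable_slab (hf : IsFokkerPlanckSolution σ lam f₀ f) (T : ℝ) :
    Integrable (fun p : ℝ × ℝ => f p.1 p.2) (slab T) := by
  obtain ⟨C, hC⟩ := hf.bounded_integral T
  exact integrable_slab_of_bounded (C := C)
    (hf.continuousOn.mono (prod_mono Ioi_subset_Ici_self le_rfl))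
    (fun t ht => hf.integrable t ht.1.le) (fun t ht => hC t ⟨ht.1.le, ht.2⟩)

end IsFokkerPlanckSolution

/-- The adjoint operator applied to `outerCutoff n`. -/
noncomputable def outerAdj (σ lam n v : ℝ) : ℝ := -stepAdj σ lam n⁻¹ v - stepAdj σ lam (-n⁻¹) v

lemma outer_adj_eq' (σ lam n : ℝ) :
    fokkerPlanckAdj σ lam (fun v => -scaledStepDeriv n⁻¹ v - scaledStepDeriv (-n⁻¹) v)
      (fun v => -scaledStepDerivTwo n⁻¹ v - scaledStepDerivTwo (-n⁻¹) v) = outerAdj σ lam n :=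
  funext fun v => outer_adj_eq σ lam n v

lemma outerAdj_bound (σ lam : ℝ) : ∃ C, 0 ≤ C ∧ ∀ n : ℝ, 1 ≤ n → ∀ v, |outerAdj σ lam n v| ≤ C := by
  obtain ⟨C, hC, h⟩ := stepAdj_bound σ lam
  refine ⟨C * 2 + C * 2, by positivity, fun n hn v => ?_⟩
  have hn' : |n⁻¹| ≤ 1 := by
    rw [abs_of_pos (inv_pos.2 (by linarith))]; exact inv_le_one_of_one_le₀ hn
  have h1 := h n⁻¹ v
  have h2 := h (-n⁻¹) v
  rw [abs_neg] at h2
  have h3 : C * (1 + |n⁻¹|) ≤ C * 2 := by gcongr; linarith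
  refine (abs_sub _ _).trans ?_
  rw [abs_neg]
  linarith

lemma outerAdj_eq_zero (σ lam : ℝ) {n v : ℝ} (hn : 0 < n) (hv : |v| ≤ n) :
    outerAdj σ lam n v = 0 := by
  have h : |n⁻¹| * |v| ≤ 1 := by
    rw [abs_of_pos (inv_pos.2 hn), inv_mul_eq_div, div_le_one hn]; exact hv
  rw [outerAdj, stepAdj_tail_eq_zero σ lam h, stepAdj_tail_eq_zero σ lam (by rwa [abs_neg])]
  ring

lemma outerAdj_eq_zero' (σ lam : ℝ) {n v : ℝ} (hn : 0 < n) (hv : 2 * n ≤ |v|) :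
    outerAdj σ lam n v = 0 := by
  rw [← outer_adj_eq']
  refine (isCutoff_outer hn).adj_zero σ lam fun h => ?_
  have : |v| < 2 * n := abs_lt.2 h
  linarith

lemma eventually_le_cast (v : ℝ) : ∀ᶠ n : ℕ in atTop, v ≤ (n : ℝ) + 2 := by
  filter_upwards [tendsto_natCast_atTop_atTop.eventually_ge_atTop v] with n hn
  linarith

lemma tendsto_integral_mul_outerCutoff {g : ℝ → ℝ} (hg : Integrable g) :
    Tendsto (fun n : ℕ => ∫ v, g v * outerCutoff ((n : ℝ) + 2) v) atTop (𝓝 (∫ v, g v)) := by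
  refine tendsto_integral_of_dominated_convergence (fun v => |g v|) (fun n => ?_) hg.abs
    (fun n => ?_) ?_
  · exact hg.aestronglyMeasurable.mul
      (isCutoff_outer (n := (n : ℝ) + 2) (by positivity)).continuous.aestronglyMeasurable
  · refine ae_of_all _ fun v => ?_
    have h := outerCutoff_mem (n := (n : ℝ) + 2) (by positivity) v
    rw [norm_mul, Real.norm_of_nonneg h.1]
    exact mul_le_of_le_one_right (abs_nonneg _) h.2
  · refine ae_of_all _ fun v => tendsto_const_nhds.congr' ?_
    filter_upwards [eventually_le_cast |v|] with n hn
    rw [outerCutoff_eq_one (by positivity) hn, mul_one]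

namespace IsFokkerPlanckSolution

variable {σ lam : ℝ} {f₀ : ℝ → ℝ} {f : ℝ → ℝ → ℝ}

/-- Test with the cutoff at infinity: its image under the adjoint is bounded uniformly and
eventually zero at each point, while `f` is integrable on the slab. -/
theorem integral_eq (hf : IsFokkerPlanckSolution σ lam f₀ f) {T : ℝ} (hT : 0 < T) :
    ∫ v, f T v = ∫ v, f 0 v := by
  obtain ⟨C, hC, hB⟩ := outerAdj_bound σ lam
  have hbal := fun n : ℕ => weak_balance (σ := σ) (lam := lam) hT hf.hasParabolicJet
    (isCutoff_outer (n := (n : ℝ) + 2) (by positivity)) (subset_univ _) (P := fun _ _ => 0)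
    (fun _ _ _ _ => le_rfl) (fun t ht v _ => by rw [hf.deriv_time_eq ht v, sub_zero])
  simp only [outer_adj_eq', zero_mul, integral_zero] at hbal
  have h1 := tendsto_integral_mul_outerCutoff (hf.integrable T hT.le)
  have h0 := tendsto_integral_mul_outerCutoff (hf.integrable 0 le_rfl)
  have h2 := tendsto_slab_integral_tail (T := T) (g := fun _ p => f p.1 p.2)
    (H := fun p => |f p.1 p.2|) (B := fun n => outerAdj σ lam ((n : ℝ) + 2))
    (fun n => (hbal n).1.aestronglyMeasurable) (hf.integrable_slab T).abs hC
    (Eventually.of_forall fun n => ae_of_all _ fun p _ => le_rfl)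
    (Eventually.of_forall fun n v => hB _ (by linarith [n.cast_nonneg (α := ℝ)]) v)
    (fun v => by
      filter_upwards [eventually_le_cast |v|] with n hn
      exact outerAdj_eq_zero σ lam (by positivity) hn)
  have h3 := (h0.sub h1).add h2
  have h4 := h3.congr (fun n => ((hbal n).2.2).symm)
  have := tendsto_nhds_unique h4 tendsto_const_nhds
  linarith

/-- The jet of the convex function `(√(f² + k) - f) / 2`, a smoothed negative part of `f`. -/
lemma hasParabolicJet_negPart (hf : IsFokkerPlanckSolution σ lam f₀ f) {k : ℝ} (hk : 0 < k) :
    HasParabolicJet (fun t v => (√(f t v ^ 2 + k) - f t v) / 2)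
      (fun t v => (f t v * deriv (fun s => f s v) t / √(f t v ^ 2 + k)
        - deriv (fun s => f s v) t) / 2)
      (fun t v => (f t v * deriv (f t) v / √(f t v ^ 2 + k) - deriv (f t) v) / 2)
      (fun t v => ((deriv (f t) v ^ 2 + f t v * deriv (deriv (f t)) v) / √(f t v ^ 2 + k)
        - f t v ^ 2 * deriv (f t) v ^ 2 / √(f t v ^ 2 + k) ^ 3 - deriv (deriv (f t)) v) / 2)
      univ := by
  have hj := hf.hasParabolicJet
  have c0 := hj.cont
  have c0' := hj.cont.mono (prod_mono Ioi_subset_Ici_self (le_refl univ))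
  have ct := hj.cont_time
  have c1 := hj.cont_space
  have c2 := hj.cont_space_two
  have hpos : ∀ t v, 0 < f t v ^ 2 + k := fun t v => by positivity
  have hr : ∀ t v, √(f t v ^ 2 + k) ≠ 0 := fun t v => (Real.sqrt_pos.2 (hpos t v)).ne'
  have hsq : ∀ {g : ℝ → ℝ} {d x : ℝ}, HasDerivAt g d x →
      HasDerivAt (fun y => √(g y ^ 2 + k)) (g x * d / √(g x ^ 2 + k)) x := by
    intro g d x hg
    have := ((hg.fun_pow 2).add_const k).sqrt (by positivity)
    refine this.congr_deriv ?_
    push_cast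
    field_simp
  refine ⟨?_, ?_, ?_, ?_, fun t ht v _ => ?_, fun t ht v _ => ?_, fun t ht v _ => ?_⟩
  · fun_prop
  · exact ((((c0'.mul ct).div (by fun_prop) fun p _ => hr _ _).sub ct).div_const 2)
  · exact ((((c0'.mul c1).div (by fun_prop) fun p _ => hr _ _).sub c1).div_const 2)
  · exact ((((((c1.pow 2).add (c0'.mul c2)).div (by fun_prop) fun p _ => hr _ _).sub
      (((c0'.pow 2).mul (c1.pow 2)).div (by fun_prop) fun p _ => pow_ne_zero 3 (hr _ _))).sub
      c2).div_const 2)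
  · exact ((hsq (hj.time t ht v trivial)).sub (hj.time t ht v trivial)).div_const 2
  · exact ((hsq (hj.space t ht v trivial)).sub (hj.space t ht v trivial)).div_const 2
  · have d0 := hf.differentiable ht v
    have d1 := hf.differentiable_deriv ht v
    refine ((((d0.mul d1).div (hsq d0) (hr t v)).sub d1).div_const 2).congr_deriv ?_
    simp only [Pi.mul_apply]
    have := hr t v
    field_simp

/-- For convex `β`, `L (β(f)) = β'(f) L f + (σ/2) v² β''(f) f_v² + (σ + λ) (β(f) - f β'(f))`. With
`β(f) = (√(f² + k) - f)/2` one has `β'' = k / (2 √(f² + k)³)` and `β - f β' = k / (2 √(f² + k))`, so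
both corrections are nonnegative. -/
lemma negPart_equation {σ lam v k F Ft Fv Fvv : ℝ} (hk : 0 < k)
    (h : Ft = fokkerPlanckOp σ lam v F Fv Fvv) :
    (F * Ft / √(F ^ 2 + k) - Ft) / 2 =
      fokkerPlanckOp σ lam v ((√(F ^ 2 + k) - F) / 2) ((F * Fv / √(F ^ 2 + k) - Fv) / 2)
        (((Fv ^ 2 + F * Fvv) / √(F ^ 2 + k) - F ^ 2 * Fv ^ 2 / √(F ^ 2 + k) ^ 3 - Fvv) / 2)
      - (σ / 2 * v ^ 2 * (Fv ^ 2 * k / (2 * √(F ^ 2 + k) ^ 3))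
        + (σ + lam) * (k / (2 * √(F ^ 2 + k)))) := by
  have hr : 0 < √(F ^ 2 + k) := Real.sqrt_pos.2 (by positivity)
  have hk' : k = √(F ^ 2 + k) ^ 2 - F ^ 2 := by rw [Real.sq_sqrt (by positivity)]; ring
  set r := √(F ^ 2 + k)
  rw [h, hk', fokkerPlanckOp, fokkerPlanckOp]
  field_simp
  ring

/-- The smoothed negative part is a subsolution, so its integral cannot grow beyond the cutoff
error. It starts at the size of the smoothing, and removing smoothing and cutoff together leaves the
negative part of `f T` with integral zero. -/
theorem nonneg (hf : IsFokkerPlanckSolution σ lam f₀ f) (hσ : 0 < σ) (hlam : 0 < lam)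
    (h0 : ∀ v, 0 ≤ f₀ v) {T : ℝ} (hT : 0 < T) (v : ℝ) : 0 ≤ f T v := by
  obtain ⟨C, hC, hB⟩ := outerAdj_bound σ lam
  let N : ℕ → ℝ := fun n => (n : ℝ) + 2
  have hN : ∀ n, 2 ≤ N n := fun n => by simp [N]
  have hN0 : ∀ n, 0 < N n := fun n => by linarith [hN n]
  -- The smoothing adds a constant up to `κ n`, not integrable on the line. This choice gives `κ n ≤
  -- 1 / (1 + v²)` on `|v| ≤ 2 N n`, the support of the cutoff, hence an integrable majorant
  -- independent of `n`.
  let κ : ℕ → ℝ := fun n => (1 + (2 * N n) ^ 2)⁻¹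
  have hκ : ∀ n, 0 < κ n := fun n => by positivity
  let e : ℕ → ℝ → ℝ → ℝ := fun n t v => (√(f t v ^ 2 + κ n ^ 2) - f t v) / 2
  have hup : ∀ n t v, e n t v ≤ |f t v| + κ n := by
    intro n t v
    have h1 : √(f t v ^ 2 + κ n ^ 2) ≤ |f t v| + κ n := by
      refine Real.sqrt_le_iff.2 ⟨by have := hκ n; positivity, ?_⟩
      have := sq_abs (f t v)
      nlinarith [mul_nonneg (abs_nonneg (f t v)) (hκ n).le]
    have h2 := neg_abs_le (f t v)
    have h3 := hκ n
    simp only [e]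
    linarith
  have hlow : ∀ n t v, max (-f t v) 0 ≤ e n t v := by
    intro n t v
    have h1 : |f t v| ≤ √(f t v ^ 2 + κ n ^ 2) := by
      rw [← Real.sqrt_sq_eq_abs]
      exact Real.sqrt_le_sqrt (by nlinarith [hκ n])
    have h2 := neg_abs_le (f t v)
    have h3 := le_abs_self (f t v)
    simp only [e]
    exact max_le (by linarith) (by linarith)
  have hbal := fun n : ℕ => weak_balance (σ := σ) (lam := lam) hT
    (hf.hasParabolicJet_negPart (pow_pos (hκ n) 2))
    (isCutoff_outer (n := N n) (hN0 n)) (subset_univ _)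
    (P := fun t v => σ / 2 * v ^ 2 * (deriv (f t) v ^ 2 * κ n ^ 2
        / (2 * √(f t v ^ 2 + κ n ^ 2) ^ 3))
        + (σ + lam) * (κ n ^ 2 / (2 * √(f t v ^ 2 + κ n ^ 2))))
    (fun t _ v _ => by positivity)
    (fun t ht v _ => negPart_equation (pow_pos (hκ n) 2) (hf.deriv_time_eq ht v))
  simp only [outer_adj_eq'] at hbal
  have htail := tendsto_slab_integral_tail (T := T) (g := fun n p => e n p.1 p.2)
    (H := fun p => |f p.1 p.2| + (1 + p.2 ^ 2)⁻¹) (B := fun n => outerAdj σ lam (N n))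
    (fun n => (hbal n).1.aestronglyMeasurable)
    ((hf.integrable_slab T).abs.add (integrable_slab_snd integrable_inv_one_add_sq T)) hC
    (Eventually.of_forall fun n => ae_of_all _ fun p hp => by
      have hv : |p.2| ≤ 2 * N n := by
        by_contra h
        exact hp (outerAdj_eq_zero' σ lam (hN0 n) (not_le.1 h).le)
      rw [abs_of_nonneg ((le_max_right _ _).trans (hlow n p.1 p.2))]
      refine (hup n p.1 p.2).trans (add_le_add le_rfl ?_)
      refine inv_anti₀ (by positivity) ?_
      have := sq_le_sq' (by linarith [abs_nonneg p.2]) hv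
      rw [sq_abs] at this
      linarith)
    (Eventually.of_forall fun n v => hB _ (by linarith [hN n]) v)
    (fun v => by
      filter_upwards [eventually_le_cast |v|] with n hn
      exact outerAdj_eq_zero σ lam (hN0 n) hn)
  have hneg : Integrable (fun v => max (-f T v) 0) := (hf.integrable T hT.le).neg.pos_part
  have hlim := tendsto_integral_mul_outerCutoff hneg
  -- Where `f 0 ≥ 0` the smoothed negative part is at most `κ n / 2`; the cutoff is supported on a
  -- length `4 N n`, and `2 N n κ n ≤ 1 / N n`.
  have hinit : ∀ n, ∫ v, e n 0 v * outerCutoff (N n) v ≤ (N n)⁻¹ := by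
    intro n
    have hcut := isCutoff_outer (n := N n) (hN0 n)
    rw [integral_eq_intervalIntegral_of_zero hcut.lt.le (fun v hv => by
      rw [hcut.zero v fun h => hv (Ioo_subset_Icc_self h), mul_zero])]
    have hle : ∀ v, ‖e n 0 v * outerCutoff (N n) v‖ ≤ κ n / 2 := by
      intro v
      have hm := outerCutoff_mem (hN0 n) v
      have hp := h0 v
      rw [← hf.initial v] at hp
      have he0 := (le_max_right _ _).trans (hlow n 0 v)
      rw [Real.norm_of_nonneg (mul_nonneg he0 hm.1)]
      refine (mul_le_of_le_one_right he0 hm.2).trans ?_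
      have h1 : √(f 0 v ^ 2 + κ n ^ 2) ≤ f 0 v + κ n := by
        refine Real.sqrt_le_iff.2 ⟨by have := hκ n; positivity, ?_⟩
        nlinarith [mul_nonneg hp (hκ n).le]
      simp only [e]
      linarith
    refine (le_abs_self _).trans ((intervalIntegral.norm_integral_le_of_norm_le_const
      fun v _ => hle v).trans ?_)
    have hN' := hN0 n
    rw [abs_of_nonneg (by linarith)]
    simp only [κ]
    rw [inv_eq_one_div, inv_eq_one_div, div_div, div_mul_eq_mul_div, div_le_div_iff₀
      (by positivity) hN']
    nlinarith
  -- The production is nonnegative and is dropped; the true negative part lies below the smoothed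
  -- one.
  have hle : ∀ n : ℕ, ∫ v, max (-f T v) 0 * outerCutoff ((n : ℝ) + 2) v ≤
      (N n)⁻¹ + ∫ p, e n p.1 p.2 * outerAdj σ lam (N n) p.2 ∂(slab T) := by
    intro n
    have hcut := isCutoff_outer (n := N n) (hN0 n)
    have hT' : ∫ v, max (-f T v) 0 * outerCutoff ((n : ℝ) + 2) v ≤
        ∫ v, e n T v * outerCutoff (N n) v := by
      have cf : Continuous (f T) := (hf.contDiff_space T hT).continuous
      have cc := hcut.continuous
      have hsupp : ∀ {g : ℝ → ℝ}, Continuous g →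
          Integrable (fun v => g v * outerCutoff (N n) v) := fun hg =>
        (hg.mul cc).integrable_of_hasCompactSupport (HasCompactSupport.intro
          (isCompact_Icc (a := -(2 * N n)) (b := 2 * N n)) fun v hv => by
          rw [Pi.mul_apply, hcut.zero v fun h => hv (Ioo_subset_Icc_self h), mul_zero])
      refine integral_mono (hsupp (by fun_prop)) (hsupp (by fun_prop)) fun v => ?_
      exact mul_le_mul_of_nonneg_right (hlow n T v) (hcut.nonneg v)
    have hPn : 0 ≤ ∫ p : ℝ × ℝ, (σ / 2 * p.2 ^ 2 * (deriv (f p.1) p.2 ^ 2 * κ n ^ 2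
        / (2 * √(f p.1 p.2 ^ 2 + κ n ^ 2) ^ 3))
        + (σ + lam) * (κ n ^ 2 / (2 * √(f p.1 p.2 ^ 2 + κ n ^ 2))))
        * outerCutoff (N n) p.2 ∂(slab T) :=
      integral_nonneg fun p => mul_nonneg (by positivity) (hcut.nonneg p.2)
    rw [(hbal n).2.2] at hPn
    have := hinit n
    simp only [e] at this hT' ⊢
    linarith
  have hinv : Tendsto (fun n => (N n)⁻¹) atTop (𝓝 0) :=
    (tendsto_atTop_add_const_right _ _ tendsto_natCast_atTop_atTop).inv_tendsto_atTop
  have hfin := le_of_tendsto_of_tendsto' hlim (hinv.add htail) hle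
  rw [add_zero] at hfin
  have hz : ∫ v, max (-f T v) 0 = 0 :=
    le_antisymm hfin (integral_nonneg fun v => le_max_right _ _)
  have hz' := (integral_eq_zero_iff_of_nonneg (f := fun v => max (-f T v) 0)
    (fun v => le_max_right _ _) hneg).1 hz
  have cf : Continuous (f T) := (hf.contDiff_space T hT).continuous
  have hz'' := (Continuous.ae_eq_iff_eq (μ := volume)
    (f := fun v => max (-f T v) 0) (g := 0) (by fun_prop) continuous_const).1 hz'
  have := congrFun hz'' v
  have h' := le_max_left (-f T v) 0
  simp only [Pi.zero_apply] at this
  linarith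

end IsFokkerPlanckSolution

/-! ### The equilibrium -/

/-- The derivative of the equilibrium. -/
noncomputable def equilibriumDeriv (σ lam v : ℝ) : ℝ :=
  equilibrium σ lam v * (2 * lam / σ / v ^ 2 - (2 + 2 * lam / σ) / v)

/-- The second derivative of the equilibrium on the positive half-line. -/
noncomputable def equilibriumDerivTwo (σ lam v : ℝ) : ℝ :=
  equilibrium σ lam v * ((2 * lam / σ / v ^ 2 - (2 + 2 * lam / σ) / v) ^ 2
    + (-2 * (2 * lam / σ) / v ^ 3 + (2 + 2 * lam / σ) / v ^ 2))

section Equilibrium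

variable {σ lam : ℝ}

/-- The normalizing constant of the equilibrium. -/
noncomputable def equilibriumConst (σ lam : ℝ) : ℝ :=
  (2 * lam / σ) ^ (1 + 2 * lam / σ) / Real.Gamma (1 + 2 * lam / σ)

lemma equilibrium_of_pos {v : ℝ} (hv : 0 < v) : equilibrium σ lam v =
    equilibriumConst σ lam * (Real.exp (-(2 * lam / σ) / v) / v ^ (2 + 2 * lam / σ)) := by
  rw [equilibrium, if_pos hv, paretoExponent, equilibriumConst, add_sub_cancel_left, ← add_assoc]
  norm_num

lemma equilibrium_of_nonpos {v : ℝ} (hv : v ≤ 0) : equilibrium σ lam v = 0 :=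
  if_neg (not_lt.2 hv)

lemma equilibriumConst_pos (hσ : 0 < σ) (hlam : 0 < lam) : 0 < equilibriumConst σ lam :=
  div_pos (Real.rpow_pos_of_pos (by positivity) _) (Real.Gamma_pos_of_pos (by positivity))

lemma equilibrium_pos (hσ : 0 < σ) (hlam : 0 < lam) {v : ℝ} (hv : 0 < v) :
    0 < equilibrium σ lam v := by
  rw [equilibrium_of_pos hv]
  have := equilibriumConst_pos hσ hlam
  positivity

lemma equilibrium_nonneg (hσ : 0 < σ) (hlam : 0 < lam) (v : ℝ) : 0 ≤ equilibrium σ lam v := by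
  rcases le_or_gt v 0 with h | h
  · rw [equilibrium_of_nonpos h]
  · exact (equilibrium_pos hσ hlam h).le

lemma hasDerivAt_equilibrium {v : ℝ} (hv : 0 < v) :
    HasDerivAt (equilibrium σ lam) (equilibriumDeriv σ lam v) v := by
  have h1 : HasDerivAt (fun v => Real.exp (-(2 * lam / σ) / v))
      (Real.exp (-(2 * lam / σ) / v) * (2 * lam / σ / v ^ 2)) v := by
    refine (((hasDerivAt_const v (-(2 * lam / σ))).div (hasDerivAt_id' v) hv.ne').exp).congr_deriv ?_
    simp only [Pi.div_apply]
    ring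
  have h2 := (Real.hasDerivAt_rpow_const (x := v) (p := 2 + 2 * lam / σ) (Or.inl hv.ne'))
  have h3 := (h1.div h2 (by positivity)).const_mul (equilibriumConst σ lam)
  refine (h3.congr_of_eventuallyEq ?_).congr_deriv ?_
  · filter_upwards [lt_mem_nhds hv] with w hw
    exact equilibrium_of_pos hw
  · rw [equilibriumDeriv, equilibrium_of_pos hv]
    have hr : v ^ (2 + 2 * lam / σ - 1) = v ^ (2 + 2 * lam / σ) / v := Real.rpow_sub_one hv.ne' _
    rw [hr]
    have hp : v ^ (2 + 2 * lam / σ) ≠ 0 := by positivity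
    generalize v ^ (2 + 2 * lam / σ) = x at *
    generalize 2 * lam / σ = q at *
    field_simp

lemma hasDerivAt_equilibriumDeriv {v : ℝ} (hv : 0 < v) :
    HasDerivAt (equilibriumDeriv σ lam) (equilibriumDerivTwo σ lam v) v := by
  have h1 : HasDerivAt (fun v => 2 * lam / σ / v ^ 2 - (2 + 2 * lam / σ) / v)
      (-2 * (2 * lam / σ) / v ^ 3 + (2 + 2 * lam / σ) / v ^ 2) v := by
    refine ((((hasDerivAt_const v (2 * lam / σ)).div (hasDerivAt_pow 2 v) (by positivity)).sub
      ((hasDerivAt_const v (2 + 2 * lam / σ)).div (hasDerivAt_id' v) hv.ne'))).congr_deriv ?_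
    push_cast
    field_simp
    ring
  refine ((hasDerivAt_equilibrium hv).mul h1).congr_deriv ?_
  rw [equilibriumDerivTwo, equilibriumDeriv]
  ring

/-- The logarithmic derivative in `equilibriumDeriv` is the one that makes the flux `(σ/2) (v² e)' +
λ (v - 1) e` itself vanish. -/
lemma fokkerPlanckOp_equilibrium (hσ : 0 < σ) {v : ℝ} (hv : 0 < v) :
    fokkerPlanckOp σ lam v (equilibrium σ lam v) (equilibriumDeriv σ lam v)
      (equilibriumDerivTwo σ lam v) = 0 := by
  rw [equilibriumDeriv, equilibriumDerivTwo, fokkerPlanckOp]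
  field_simp
  ring

lemma continuous_equilibrium (hσ : 0 < σ) (hlam : 0 < lam) : Continuous (equilibrium σ lam) := by
  rw [continuous_iff_continuousAt]
  intro v
  rcases lt_trichotomy v 0 with h | h | h
  · refine (continuousAt_const (y := (0 : ℝ))).congr ?_
    filter_upwards [gt_mem_nhds h] with w hw
    exact (equilibrium_of_nonpos hw.le).symm
  · subst h
    have hl : Tendsto (equilibrium σ lam) (𝓝[≤] 0) (𝓝 0) := by
      refine tendsto_const_nhds.congr' ?_
      filter_upwards [self_mem_nhdsWithin] with w hw
      exact (equilibrium_of_nonpos hw).symm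
    have hr : Tendsto (equilibrium σ lam) (𝓝[>] 0) (𝓝 0) := by
      -- In the variable `1 / v → ∞` the exponential decay beats the power.
      have h0 := (tendsto_rpow_mul_exp_neg_mul_atTop_nhds_zero (2 + 2 * lam / σ) (2 * lam / σ)
        (by positivity)).comp tendsto_inv_nhdsGT_zero
      have h1 := h0.const_mul (equilibriumConst σ lam)
      rw [mul_zero] at h1
      refine h1.congr' ?_
      filter_upwards [self_mem_nhdsWithin] with w hw
      rw [equilibrium_of_pos hw]
      simp only [Function.comp_apply]
      rw [Real.inv_rpow (le_of_lt hw), ← div_eq_mul_inv]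
      ring
    have h0 : equilibrium σ lam 0 = 0 := equilibrium_of_nonpos le_rfl
    have := hl.sup hr
    rw [nhdsLE_sup_nhdsGT] at this
    rwa [ContinuousAt, h0]
  · exact (hasDerivAt_equilibrium h).continuousAt

lemma integrable_equilibrium (hσ : 0 < σ) (hlam : 0 < lam) : Integrable (equilibrium σ lam) := by
  have hc := continuous_equilibrium hσ hlam
  have h1 : IntegrableOn (equilibrium σ lam) (Iic 0) :=
    (integrableOn_zero (s := Iic (0 : ℝ))).congr_fun
      (fun v hv => (equilibrium_of_nonpos hv).symm) measurableSet_Iic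
  have h2 : IntegrableOn (equilibrium σ lam) (Icc 0 1) := hc.continuousOn.integrableOn_Icc
  have h3 : IntegrableOn (equilibrium σ lam) (Ioi 1) := by
    have hq : 0 < 2 * lam / σ := by positivity
    -- Away from the origin the exponential is at most one, and the remaining power has exponent
    -- below `-2`.
    have hi := (integrableOn_Ioi_rpow_of_lt (a := -(2 + 2 * lam / σ)) (by linarith)
      one_pos).const_mul (equilibriumConst σ lam)
    refine Integrable.mono' hi hc.aestronglyMeasurable ?_
    filter_upwards [ae_restrict_mem measurableSet_Ioi] with v hv
    have hv0 : (0 : ℝ) < v := lt_trans one_pos hv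
    rw [Real.norm_of_nonneg (equilibrium_nonneg hσ hlam v), equilibrium_of_pos hv0,
      Real.rpow_neg hv0.le, ← one_div]
    refine mul_le_mul_of_nonneg_left ?_ (equilibriumConst_pos hσ hlam).le
    refine div_le_div_of_nonneg_right ?_ (by positivity)
    rw [Real.exp_le_one_iff, neg_div]
    exact neg_nonpos.2 (by positivity)
  have h4 := (h1.union h2).union h3
  have : Iic (0 : ℝ) ∪ Icc 0 1 ∪ Ioi 1 = univ := by
    ext v
    simp only [mem_union, mem_Iic, mem_Icc, mem_Ioi, mem_univ, iff_true]
    rcases le_or_gt v 0 with h | h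
    · exact Or.inl (Or.inl h)
    · rcases le_or_gt v 1 with h' | h'
      · exact Or.inl (Or.inr ⟨h.le, h'⟩)
      · exact Or.inr h'
  rwa [this, integrableOn_univ] at h4

lemma hasParabolicJet_equilibrium (hσ : 0 < σ) (hlam : 0 < lam) :
    HasParabolicJet (fun _ => equilibrium σ lam) (fun _ _ => 0) (fun _ => equilibriumDeriv σ lam)
      (fun _ => equilibriumDerivTwo σ lam) (Ioi 0) := by
  have hc := continuous_equilibrium hσ hlam
  refine ⟨?_, continuousOn_const, ?_, ?_, fun t _ v _ => hasDerivAt_const _ _,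
    fun t _ v hv => hasDerivAt_equilibrium hv, fun t _ v hv => hasDerivAt_equilibriumDeriv hv⟩
  · fun_prop
  · unfold equilibriumDeriv
    refine ContinuousOn.mul (by fun_prop) (ContinuousOn.sub (ContinuousOn.div (by fun_prop)
      (by fun_prop) ?_) (ContinuousOn.div (by fun_prop) (by fun_prop) ?_)) <;>
    · intro p hp
      have : 0 < p.2 := hp.2
      positivity
  · unfold equilibriumDerivTwo
    refine ContinuousOn.mul (by fun_prop) (ContinuousOn.add (ContinuousOn.pow (ContinuousOn.sub
      (ContinuousOn.div (by fun_prop) (by fun_prop) ?_) (ContinuousOn.div (by fun_prop)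
      (by fun_prop) ?_)) 2) (ContinuousOn.add (ContinuousOn.div (by fun_prop) (by fun_prop) ?_)
      (ContinuousOn.div (by fun_prop) (by fun_prop) ?_))) <;>
    · intro p hp
      have : 0 < p.2 := hp.2
      positivity

end Equilibrium

/-! ### Operations on jets -/

namespace HasParabolicJet

variable {e et ev evv g gt gv gvv : ℝ → ℝ → ℝ} {s s' : Set ℝ}

lemma mono (h : HasParabolicJet e et ev evv s) (hs : s' ⊆ s) : HasParabolicJet e et ev evv s' where
  cont := h.cont.mono (prod_mono le_rfl hs)
  cont_time := h.cont_time.mono (prod_mono le_rfl hs)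
  cont_space := h.cont_space.mono (prod_mono le_rfl hs)
  cont_space_two := h.cont_space_two.mono (prod_mono le_rfl hs)
  time t ht v hv := h.time t ht v (hs hv)
  space t ht v hv := h.space t ht v (hs hv)
  space_two t ht v hv := h.space_two t ht v (hs hv)

lemma lincomb (h : HasParabolicJet e et ev evv s) (k : HasParabolicJet g gt gv gvv s) (a b : ℝ) :
    HasParabolicJet (fun t v => a * e t v + b * g t v) (fun t v => a * et t v + b * gt t v)
      (fun t v => a * ev t v + b * gv t v) (fun t v => a * evv t v + b * gvv t v) s where
  cont := (h.cont.const_mul a).add (k.cont.const_mul b)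
  cont_time := (h.cont_time.const_mul a).add (k.cont_time.const_mul b)
  cont_space := (h.cont_space.const_mul a).add (k.cont_space.const_mul b)
  cont_space_two := (h.cont_space_two.const_mul a).add (k.cont_space_two.const_mul b)
  time t ht v hv := ((h.time t ht v hv).const_mul a).add ((k.time t ht v hv).const_mul b)
  space t ht v hv := ((h.space t ht v hv).const_mul a).add ((k.space t ht v hv).const_mul b)
  space_two t ht v hv :=
    ((h.space_two t ht v hv).const_mul a).add ((k.space_two t ht v hv).const_mul b)

/-- The jet of the geometric mean of two positive functions. -/
lemma sqrt_mul (h : HasParabolicJet e et ev evv s) (k : HasParabolicJet g gt gv gvv s)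
    (he : ∀ t, 0 ≤ t → ∀ v ∈ s, 0 < e t v) (hg : ∀ t, 0 ≤ t → ∀ v ∈ s, 0 < g t v) :
    HasParabolicJet (fun t v => √(e t v * g t v))
      (fun t v => √(e t v * g t v) / 2 * (et t v / e t v + gt t v / g t v))
      (fun t v => √(e t v * g t v) / 2 * (ev t v / e t v + gv t v / g t v))
      (fun t v => √(e t v * g t v) / 4 * (ev t v / e t v + gv t v / g t v) ^ 2
        + √(e t v * g t v) / 2 * (evv t v / e t v - (ev t v / e t v) ^ 2
          + (gvv t v / g t v - (gv t v / g t v) ^ 2))) s := by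
  have hsub : Ioi (0 : ℝ) ×ˢ s ⊆ Ici 0 ×ˢ s := prod_mono Ioi_subset_Ici_self le_rfl
  have c0 := h.cont.mono hsub
  have k0 := k.cont.mono hsub
  have ne : ∀ p ∈ Ioi (0 : ℝ) ×ˢ s, e p.1 p.2 ≠ 0 :=
    fun p hp => (he p.1 (le_of_lt hp.1) p.2 hp.2).ne'
  have ng : ∀ p ∈ Ioi (0 : ℝ) ×ˢ s, g p.1 p.2 ≠ 0 :=
    fun p hp => (hg p.1 (le_of_lt hp.1) p.2 hp.2).ne'
  have ch := (c0.mul k0).sqrt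
  have q1 := h.cont_space.div c0 ne
  have q2 := k.cont_space.div k0 ng
  have hsq : ∀ {x y : ℝ → ℝ} {x' y' z : ℝ}, HasDerivAt x x' z → HasDerivAt y y' z → 0 < x z →
      0 < y z → HasDerivAt (fun w => √(x w * y w)) (√(x z * y z) / 2 * (x' / x z + y' / y z)) z := by
    intro x y x' y' z hx hy px py
    refine ((hx.fun_mul hy).sqrt (mul_pos px py).ne').congr_deriv ?_
    have hr : 0 < √(x z * y z) := Real.sqrt_pos.2 (mul_pos px py)
    have hr2 : √(x z * y z) ^ 2 = x z * y z := Real.sq_sqrt (mul_pos px py).le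
    generalize √(x z * y z) = r at *
    field_simp
    rw [hr2]
    ring
  refine ⟨(h.cont.mul k.cont).sqrt,
    (ch.div_const 2).mul ((h.cont_time.div c0 ne).add (k.cont_time.div k0 ng)),
    (ch.div_const 2).mul (q1.add q2),
    ((ch.div_const 4).mul ((q1.add q2).pow 2)).add ((ch.div_const 2).mul
      (((h.cont_space_two.div c0 ne).sub (q1.pow 2)).add
        ((k.cont_space_two.div k0 ng).sub (q2.pow 2)))),
    fun t ht v hv => hsq (h.time t ht v hv) (k.time t ht v hv) (he t ht.le v hv) (hg t ht.le v hv),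
    fun t ht v hv =>
      hsq (h.space t ht v hv) (k.space t ht v hv) (he t ht.le v hv) (hg t ht.le v hv),
    fun t ht v hv => ?_⟩
  have pe := (he t ht.le v hv).ne'
  have pg := (hg t ht.le v hv).ne'
  have d0 := (hsq (h.space t ht v hv) (k.space t ht v hv) (he t ht.le v hv) (hg t ht.le v hv)).div_const 2
  have d1 := (h.space_two t ht v hv).div (h.space t ht v hv) pe
  have d2 := (k.space_two t ht v hv).div (k.space t ht v hv) pg
  refine (d0.mul (d1.add d2)).congr_deriv ?_
  simp only [Pi.add_apply, Pi.div_apply]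
  generalize √(e t v * g t v) = r
  field_simp
  ring

end HasParabolicJet

/-- The geometric mean of two solutions is a subsolution, with an explicit defect. -/
lemma fokkerPlanckOp_sqrt_mul {σ lam v F Ft Fv Fvv G Gt Gv Gvv : ℝ} (hF : 0 < F) (hG : 0 < G)
    (h : Ft = fokkerPlanckOp σ lam v F Fv Fvv) (k : Gt = fokkerPlanckOp σ lam v G Gv Gvv) :
    √(F * G) / 2 * (Ft / F + Gt / G) =
      fokkerPlanckOp σ lam v (√(F * G)) (√(F * G) / 2 * (Fv / F + Gv / G))
        (√(F * G) / 4 * (Fv / F + Gv / G) ^ 2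
          + √(F * G) / 2 * (Fvv / F - (Fv / F) ^ 2 + (Gvv / G - (Gv / G) ^ 2)))
      + σ / 8 * (v ^ 2 * (Fv * G - F * Gv) ^ 2 / (F * G * √(F * G))) := by
  have hr : 0 < √(F * G) := Real.sqrt_pos.2 (mul_pos hF hG)
  have hr2 : √(F * G) ^ 2 = F * G := Real.sq_sqrt (mul_pos hF hG).le
  -- The defect is the geometric mean times the squared difference of the logarithmic derivatives.
  -- In this form the identity is linear in the root, which then needs no further properties.
  have e1 : (Fv * G - F * Gv) ^ 2 / (F * G * √(F * G)) = √(F * G) * (Fv / F - Gv / G) ^ 2 := by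
    rw [div_eq_iff (by positivity)]
    calc (Fv * G - F * Gv) ^ 2 = (Fv / F - Gv / G) ^ 2 * (F * G) ^ 2 := by field_simp
      _ = (Fv / F - Gv / G) ^ 2 * (F * G) * √(F * G) ^ 2 := by rw [hr2]; ring
      _ = _ := by ring
  rw [mul_div_assoc, e1, h, k]
  simp only [fokkerPlanckOp]
  generalize √(F * G) = r
  field_simp
  ring

/-! ### Dissipation of the Hellinger functional -/

/-- The limit `G` is itself the majorant. Fatou's lemma, fed by the convergent integrals, shows that
`G` is integrable; dominated convergence then identifies its integral. Monotonicity in `n` is not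
needed. -/
lemma integrable_of_tendsto_of_le {β : Type*} [MeasurableSpace β] {μ : Measure β}
    {g : ℕ → β → ℝ} {G : β → ℝ} {X : ℝ} (hi : ∀ n, Integrable (g n) μ)
    (h0 : ∀ n, ∀ᵐ p ∂μ, 0 ≤ g n p) (hle : ∀ n, ∀ᵐ p ∂μ, g n p ≤ G p)
    (hlim : ∀ᵐ p ∂μ, Tendsto (fun n => g n p) atTop (𝓝 (G p)))
    (hX : Tendsto (fun n => ∫ p, g n p ∂μ) atTop (𝓝 X)) :
    Integrable G μ ∧ ∫ p, G p ∂μ = X := by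
  have hm : AEStronglyMeasurable G μ :=
    aestronglyMeasurable_of_tendsto_ae _ (fun n => (hi n).aestronglyMeasurable) hlim
  have hG0 : ∀ᵐ p ∂μ, 0 ≤ G p := by
    filter_upwards [h0 0, hle 0] with p h1 h2 using h1.trans h2
  have hint : Integrable G μ := by
    refine ⟨hm, ?_⟩
    rw [hasFiniteIntegral_iff_ofReal hG0]
    calc ∫⁻ p, ENNReal.ofReal (G p) ∂μ
        = ∫⁻ p, liminf (fun n => ENNReal.ofReal (g n p)) atTop ∂μ := by
          refine lintegral_congr_ae ?_
          filter_upwards [hlim] with p hp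
          exact (ENNReal.tendsto_ofReal hp).liminf_eq.symm
      _ ≤ liminf (fun n => ∫⁻ p, ENNReal.ofReal (g n p) ∂μ) atTop :=
          lintegral_liminf_le' fun n => (hi n).aemeasurable.ennreal_ofReal
      _ = ENNReal.ofReal X := by
          refine Tendsto.liminf_eq ?_
          refine (ENNReal.tendsto_ofReal hX).congr fun n => ?_
          exact ofReal_integral_eq_lintegral_ofReal (hi n) (h0 n)
      _ < ⊤ := ENNReal.ofReal_lt_top
  refine ⟨hint, tendsto_nhds_unique ?_ hX⟩
  refine tendsto_integral_of_dominated_convergence G (fun n => (hi n).aestronglyMeasurable) hint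
    (fun n => ?_) hlim
  filter_upwards [h0 n, hle n] with p h1 h2
  rwa [Real.norm_of_nonneg h1]

/-! ### The regularized production and the regularized gap -/

/-- The production density of the pair `x + ε m`, `α x + (1 - α) m`, in terms of the values and
the derivatives of `x` and `m`. -/
noncomputable def regProduction (α ε v x x' m m' : ℝ) : ℝ :=
  v ^ 2 * ((1 - α - α * ε) * (x' * m - x * m')) ^ 2 /
    ((x + ε * m) * (α * x + (1 - α) * m) * √((x + ε * m) * (α * x + (1 - α) * m)))

section RegProduction

variable {α ε v x x' m m' : ℝ}

lemma regProduction_eq_zero (hx : x = 0) (hx' : x' = 0) : regProduction α ε v x x' m m' = 0 := by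
  simp [regProduction, hx, hx']

/-- The denominator grows with `ε`, while the factor `1 - α - α ε` decreases and stays nonnegative
by the smallness of `ε`. If `x = 0`, then `x' = 0` as well and both sides vanish. -/
lemma regProduction_le (hα : α ∈ Ioo (0 : ℝ) 1) (hε : 0 ≤ ε) (hε' : α * ε ≤ 1 - α) (hx : 0 ≤ x)
    (hm : 0 < m) (hx' : x = 0 → x' = 0) :
    regProduction α ε v x x' m m' ≤ regProduction α 0 v x x' m m' := by
  rcases hx.eq_or_lt with h | h
  · rw [regProduction_eq_zero h.symm (hx' h.symm), regProduction_eq_zero h.symm (hx' h.symm)]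
  · have h1 : 0 < α := hα.1
    have h2 : 0 < 1 - α := by linarith [hα.2]
    have hle : (x + 0 * m) * (α * x + (1 - α) * m) ≤ (x + ε * m) * (α * x + (1 - α) * m) := by
      gcongr
    have hpos : 0 < (x + 0 * m) * (α * x + (1 - α) * m) := by
      rw [zero_mul, add_zero]; positivity
    have hs : 0 < √((x + 0 * m) * (α * x + (1 - α) * m)) := Real.sqrt_pos.2 hpos
    unfold regProduction
    refine div_le_div₀ (by positivity) ?_ (by positivity) (mul_le_mul hle
      (Real.sqrt_le_sqrt hle) hs.le (hpos.le.trans hle))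
    rw [mul_pow, mul_pow]
    have h3 : 0 ≤ α * ε := by positivity
    gcongr

lemma tendsto_regProduction (hα : α ∈ Ioo (0 : ℝ) 1) (hx : 0 ≤ x) (hm : 0 < m)
    (hx' : x = 0 → x' = 0) :
    Tendsto (fun ε => regProduction α ε v x x' m m') (𝓝 0) (𝓝 (regProduction α 0 v x x' m m')) := by
  rcases hx.eq_or_lt with h | h
  · simp only [regProduction_eq_zero h.symm (hx' h.symm)]
    exact tendsto_const_nhds
  · have h1 : 0 < α := hα.1
    have h2 : 0 < 1 - α := by linarith [hα.2]
    have hpos : 0 < (x + 0 * m) * (α * x + (1 - α) * m) := by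
      rw [zero_mul, add_zero]; positivity
    have hs : 0 < √((x + 0 * m) * (α * x + (1 - α) * m)) := Real.sqrt_pos.2 hpos
    have : ContinuousAt (fun ε => regProduction α ε v x x' m m') 0 := by
      unfold regProduction
      exact ContinuousAt.div (by fun_prop) (by fun_prop) (mul_pos hpos hs).ne'
    exact this

lemma regProduction_nonneg (hα : α ∈ Ioo (0 : ℝ) 1) (hε : 0 ≤ ε) (hx : 0 ≤ x) (hm : 0 ≤ m) :
    0 ≤ regProduction α ε v x x' m m' := by
  have h1 : 0 < α := hα.1
  have h2 : 0 < 1 - α := by linarith [hα.2]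
  unfold regProduction
  positivity

end RegProduction

/-- The difference of `√α f` and the geometric mean of `f + ε m` and `α f + (1 - α) m`. -/
noncomputable def regGap (α ε x m : ℝ) : ℝ :=
  √α * x - √((x + ε * m) * (α * x + (1 - α) * m))

section RegGap

variable {α ε x m : ℝ}

/-- An integrable majorant, uniform in `ε`, for the limits at infinity and at the two end times. -/
lemma abs_regGap_le (hα : α ∈ Ioo (0 : ℝ) 1) (hε : 0 ≤ ε) (hε' : ε ≤ 1) (hx : 0 ≤ x)
    (hm : 0 ≤ m) : |regGap α ε x m| ≤ 2 * (x + m) := by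
  have h1 : 0 < α := hα.1
  have h2 : 0 < 1 - α := by linarith [hα.2]
  have hs : √α ≤ 1 := Real.sqrt_le_one.2 hα.2.le
  have hεm : 0 ≤ ε * m := mul_nonneg hε hm
  have h3 : √((x + ε * m) * (α * x + (1 - α) * m)) ≤ x + m := by
    refine Real.sqrt_le_iff.2 ⟨by positivity, ?_⟩
    rw [sq]
    have : ε * m ≤ m := mul_le_of_le_one_left hm hε'
    have : α * x ≤ x := mul_le_of_le_one_left hx hα.2.le
    have : (1 - α) * m ≤ m := mul_le_of_le_one_left hm (by linarith)
    gcongr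
  have h4 := Real.sqrt_nonneg ((x + ε * m) * (α * x + (1 - α) * m))
  have h5 : √α * x ≤ x := mul_le_of_le_one_left hx hs
  have h6 : 0 ≤ √α * x := by positivity
  rw [regGap, abs_le]
  constructor <;> linarith

/-- At `m = 0` the product under the root is the perfect square `α x²`, which the term `√α x`
cancels; the remainder under the root is at most `(2 x + m) m`. This smallness removes the flux
through the origin. -/
lemma abs_regGap_le_sqrt (hα : α ∈ Ioo (0 : ℝ) 1) (hε : 0 ≤ ε) (hε' : ε ≤ 1) (hx : 0 ≤ x)
    (hm : 0 ≤ m) : |regGap α ε x m| ≤ √((2 * x + m) * m) := by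
  have h1 : 0 < α := hα.1
  have h2 : 0 < 1 - α := by linarith [hα.2]
  have hsq : √α ^ 2 = α := Real.sq_sqrt h1.le
  have hlow : √α * x ≤ √((x + ε * m) * (α * x + (1 - α) * m)) := by
    refine Real.le_sqrt_of_sq_le ?_
    rw [mul_pow, hsq]
    calc α * x ^ 2 = (x + 0) * (α * x + 0) := by ring
      _ ≤ _ := by gcongr <;> positivity
  have hup : √((x + ε * m) * (α * x + (1 - α) * m)) ≤ √α * x + √((2 * x + m) * m) := by
    refine Real.sqrt_le_iff.2 ⟨by positivity, ?_⟩
    have h3 : √((2 * x + m) * m) ^ 2 = (2 * x + m) * m := Real.sq_sqrt (by positivity)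
    have h4 : 0 ≤ √α * x * √((2 * x + m) * m) := by positivity
    have h5 : ε * (m * (α * x + (1 - α) * m)) ≤ m * (x + m) := by
      have : α * x ≤ x := mul_le_of_le_one_left hx hα.2.le
      have : (1 - α) * m ≤ m := mul_le_of_le_one_left hm (by linarith)
      calc ε * (m * (α * x + (1 - α) * m)) ≤ 1 * (m * (x + m)) := by gcongr
        _ = _ := one_mul _
    have h6 : x * ((1 - α) * m) ≤ x * m := by
      gcongr; exact mul_le_of_le_one_left hm (by linarith)
    have h7 : (√α * x) ^ 2 = α * x ^ 2 := by rw [mul_pow, hsq]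
    nlinarith
  rw [regGap, abs_le]
  have := Real.sqrt_nonneg ((2 * x + m) * m)
  constructor <;> linarith

lemma regGap_zero_right (hα : 0 ≤ α) (hx : 0 ≤ x) : regGap α ε x 0 = 0 := by
  have : (x + ε * 0) * (α * x + (1 - α) * 0) = α * x ^ 2 := by ring
  rw [regGap, this, Real.sqrt_mul hα, Real.sqrt_sq hx, sub_self]

lemma continuous_regGap (α : ℝ) :
    Continuous (fun q : ℝ × ℝ × ℝ => regGap α q.1 q.2.1 q.2.2) := by
  unfold regGap
  fun_prop

end RegGap

/-! ### Boundary terms at the origin and at infinity -/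

lemma innerStep_tail (σ lam : ℝ) : ∃ C, 0 ≤ C ∧
    (∀ n : ℕ, ∀ v, |stepAdj σ lam ((n : ℝ) + 2)⁻¹ v| ≤ C) ∧
    (∀ n : ℕ, ∀ v, |stepAdj σ lam ((n : ℝ) + 2) v| ≤ C * ((n : ℝ) + 2)) ∧
    ∀ v, ∀ᶠ n : ℕ in atTop, stepAdj σ lam ((n : ℝ) + 2)⁻¹ v = 0 := by
  obtain ⟨C, hC, h⟩ := stepAdj_bound σ lam
  refine ⟨C * 2, by positivity, fun n v => (h _ v).trans ?_, fun n v => (h _ v).trans ?_,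
    fun v => ?_⟩
  · have hn : (1 : ℝ) ≤ (n : ℝ) + 2 := by linarith [n.cast_nonneg (α := ℝ)]
    rw [abs_of_pos (by positivity)]
    have := inv_le_one_of_one_le₀ hn
    gcongr
    linarith
  · rw [abs_of_pos (by positivity), mul_assoc]
    have := n.cast_nonneg (α := ℝ)
    gcongr
    linarith
  · filter_upwards [eventually_le_cast |v|] with n hn
    refine stepAdj_tail_eq_zero σ lam ?_
    rw [abs_of_pos (by positivity), inv_mul_eq_div, div_le_one (by positivity)]
    exact hn

/-- A function vanishing at `v = 0`, uniformly in time, has no boundary flux through the origin. -/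
lemma tendsto_slab_integral_origin {σ lam T K : ℝ} (hT : 0 < T) {m : ℝ → ℝ}
    (hm : Continuous m) (hm0 : m 0 = 0) {g : ℕ → ℝ × ℝ → ℝ}
    (hg : ∀ n, ∀ p : ℝ × ℝ, p.1 ∈ Ioc 0 T → p.2 ∈ Icc (0 : ℝ) 1 → |g n p| ≤ √(K * m p.2))
    (hK : 0 ≤ K) :
    Tendsto (fun n : ℕ => ∫ p, g n p * stepAdj σ lam ((n : ℝ) + 2) p.2 ∂(slab T)) atTop (𝓝 0) := by
  obtain ⟨C, hC, -, hB, -⟩ := innerStep_tail σ lam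
  have hr : ∀ n : ℕ, (0 : ℝ) ≤ 2 / ((n : ℝ) + 2) := fun n => by positivity
  have hmax : ∀ n : ℕ, ∃ w ∈ Icc (0 : ℝ) (2 / ((n : ℝ) + 2)),
      ∀ v ∈ Icc (0 : ℝ) (2 / ((n : ℝ) + 2)), m v ≤ m w := fun n => by
    obtain ⟨w, hw, h⟩ := isCompact_Icc.exists_isMaxOn (nonempty_Icc.2 (hr n)) hm.continuousOn
    exact ⟨w, hw, fun v hv => h hv⟩
  choose w hw hmw using hmax
  have hrlim : Tendsto (fun n : ℕ => 2 / ((n : ℝ) + 2)) atTop (𝓝 0) :=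
    tendsto_const_nhds.div_atTop
      (tendsto_atTop_add_const_right _ _ tendsto_natCast_atTop_atTop)
  have hwlim : Tendsto w atTop (𝓝 0) :=
    squeeze_zero (fun n => (hw n).1) (fun n => (hw n).2) hrlim
  -- The adjoint of the cutoff is at most `C (n + 2)` on a strip of area `2 T / (n + 2)`, so the two
  -- factors compensate to `2 C T`; the decay comes from the maximum of `m` over the shrinking
  -- interval.
  have hω : Tendsto (fun n => √(K * m (w n)) * (C * (2 * T))) atTop (𝓝 0) := by
    have h : Continuous fun v => √(K * m v) * (C * (2 * T)) := by fun_prop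
    have := (h.tendsto 0).comp hwlim
    simpa [hm0, Function.comp_def] using this
  refine squeeze_zero_norm (fun n => ?_) hω
  have hn : (0 : ℝ) < (n : ℝ) + 2 := by positivity
  set s : Set (ℝ × ℝ) := univ ×ˢ Icc (0 : ℝ) (2 / ((n : ℝ) + 2)) with hs
  have hz : ∀ p, p ∉ s → g n p * stepAdj σ lam ((n : ℝ) + 2) p.2 = 0 := by
    intro p hp
    rw [stepAdj_eq_zero, mul_zero]
    rintro ⟨h1, h2⟩
    refine hp ⟨trivial, ?_, ?_⟩
    · by_contra h
      nlinarith [not_le.1 h]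
    · rw [le_div_iff₀ hn]; linarith
  rw [← setIntegral_eq_integral_of_forall_compl_eq_zero hz]
  have hvol : (slab T) s = ENNReal.ofReal (T * (2 / ((n : ℝ) + 2))) := by
    rw [hs, Measure.prod_prod, Measure.restrict_apply_univ, Real.volume_Ioc, Real.volume_Icc,
      ← ENNReal.ofReal_mul (by linarith), sub_zero, sub_zero]
  have hbound := norm_setIntegral_le_of_norm_le_const_ae (μ := slab T) (s := s)
    (f := fun p => g n p * stepAdj σ lam ((n : ℝ) + 2) p.2)
    (C := √(K * m (w n)) * (C * ((n : ℝ) + 2))) (by rw [hvol]; exact ENNReal.ofReal_lt_top) ?_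
  · refine hbound.trans (le_of_eq ?_)
    rw [Measure.real, hvol, ENNReal.toReal_ofReal (by positivity)]
    field_simp
  · filter_upwards [ae_restrict_of_ae (ae_slab_pos T),
      ae_restrict_mem (MeasurableSet.univ.prod measurableSet_Icc)] with p hp hps
    have hp2 : p.2 ∈ Icc (0 : ℝ) (2 / ((n : ℝ) + 2)) := hps.2
    rw [norm_mul]
    refine mul_le_mul ?_ (hB n p.2) (abs_nonneg _) (Real.sqrt_nonneg _)
    refine (hg n p hp ⟨hp2.1, hp2.2.trans ?_⟩).trans (Real.sqrt_le_sqrt ?_)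
    · rw [div_le_one hn]; linarith [n.cast_nonneg (α := ℝ)]
    · exact mul_le_mul_of_nonneg_left (hmw n _ hp2) hK

namespace IsFokkerPlanckSolution

variable {σ lam α : ℝ} {f₀ : ℝ → ℝ} {f : ℝ → ℝ → ℝ}

lemma continuous_slice (hf : IsFokkerPlanckSolution σ lam f₀ f) {t : ℝ} (ht : 0 ≤ t) :
    Continuous (f t) :=
  continuousOn_univ.1 (slice_continuousOn hf.continuousOn (mem_Ici.2 ht))

/-- The truncated and regularized gap converges, in mean, to the gap itself. -/
lemma tendsto_integral_regGap (hf : IsFokkerPlanckSolution σ lam f₀ f) (hσ : 0 < σ)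
    (hlam : 0 < lam) (hα : α ∈ Ioo (0 : ℝ) 1) {t : ℝ} (ht : 0 ≤ t) (hpos : ∀ v, 0 ≤ f t v)
    {ε : ℕ → ℝ} (hε : ∀ n, ε n ∈ Icc (0 : ℝ) 1) (hεlim : Tendsto ε atTop (𝓝 0)) :
    Tendsto (fun n : ℕ => ∫ v, regGap α (ε n) (f t v) (equilibrium σ lam v)
      * innerCutoff ((n : ℝ) + 2) v) atTop
      (𝓝 (∫ v, regGap α 0 (f t v) (equilibrium σ lam v))) := by
  have cf := hf.continuous_slice ht
  have cm := continuous_equilibrium hσ hlam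
  have cr := continuous_regGap α
  refine tendsto_integral_of_dominated_convergence
    (fun v => 2 * (f t v + equilibrium σ lam v)) (fun n => ?_)
    (((hf.integrable t ht).add (integrable_equilibrium hσ hlam)).const_mul 2) (fun n => ?_) ?_
  · have cc := (isCutoff_inner (n := (n : ℝ) + 2) (by linarith [n.cast_nonneg (α := ℝ)])).continuous
    have : Continuous fun v => regGap α (ε n) (f t v) (equilibrium σ lam v) :=
      cr.comp (continuous_const.prodMk (cf.prodMk cm))
    exact (this.mul cc).aestronglyMeasurable
  · refine ae_of_all _ fun v => ?_
    have hc := innerCutoff_mem (n := (n : ℝ) + 2) (by linarith [n.cast_nonneg (α := ℝ)]) v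
    rw [norm_mul, Real.norm_of_nonneg hc.1]
    exact (mul_le_of_le_one_right (norm_nonneg _) hc.2).trans
      (abs_regGap_le hα (hε n).1 (hε n).2 (hpos v) (equilibrium_nonneg hσ hlam v))
  · refine ae_of_all _ fun v => ?_
    rcases le_or_gt v 0 with hv | hv
    · simp only [equilibrium_of_nonpos hv, regGap_zero_right hα.1.le (hpos v), zero_mul]
      exact tendsto_const_nhds
    · have h1 : Tendsto (fun n => regGap α (ε n) (f t v) (equilibrium σ lam v)) atTop
          (𝓝 (regGap α 0 (f t v) (equilibrium σ lam v))) :=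
        (cr.tendsto (0, f t v, equilibrium σ lam v)).comp
          (hεlim.prodMk_nhds tendsto_const_nhds)
      refine h1.congr' ?_
      filter_upwards [eventually_le_cast v, eventually_le_cast (2 / v)] with n hn hn'
      rw [innerCutoff_eq_one (by positivity) _ hn, mul_one]
      rwa [div_le_iff₀ hv] at hn'

lemma deriv_eq_zero_of_eq_zero {g : ℝ → ℝ} (hg : ∀ v, 0 ≤ g v) {v : ℝ} (h : g v = 0) :
    deriv g v = 0 :=
  IsLocalMin.deriv_eq_zero (Eventually.of_forall fun w => by rw [h]; exact hg w)

/-- The weak balance for the regularized gap on `v > 0`, with the cutoff and the regularization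
removed together. It is here that the absence of a flux at the origin is used. -/
theorem production_balance (hf : IsFokkerPlanckSolution σ lam f₀ f) (hσ : 0 < σ)
    (hlam : 0 < lam) (h0 : ∀ v, 0 ≤ f₀ v) (hα : α ∈ Ioo (0 : ℝ) 1) {T : ℝ} (hT : 0 < T) :
    Integrable (fun p : ℝ × ℝ => σ / 8 * regProduction α 0 p.2 (f p.1 p.2) (deriv (f p.1) p.2)
      (equilibrium σ lam p.2) (equilibriumDeriv σ lam p.2)) (slab T) ∧
    ∫ p, σ / 8 * regProduction α 0 p.2 (f p.1 p.2) (deriv (f p.1) p.2)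
      (equilibrium σ lam p.2) (equilibriumDeriv σ lam p.2) ∂(slab T) =
      (∫ v, regGap α 0 (f 0 v) (equilibrium σ lam v))
        - ∫ v, regGap α 0 (f T v) (equilibrium σ lam v) := by
  have h1 : 0 < α := hα.1
  have h2 : 0 < 1 - α := by linarith [hα.2]
  have hpos : ∀ t, 0 ≤ t → ∀ v, 0 ≤ f t v := by
    intro t ht v
    rcases ht.eq_or_lt with h | h
    · rw [← h, hf.initial]; exact h0 v
    · exact hf.nonneg hσ hlam h0 h v
  have cm := continuous_equilibrium hσ hlam
  have hm0 : ∀ v, 0 ≤ equilibrium σ lam v := equilibrium_nonneg hσ hlam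
  let N : ℕ → ℝ := fun n => (n : ℝ) + 2
  have hN : ∀ n, 2 ≤ N n := fun n => by simp [N]
  have hN0 : ∀ n, 0 < N n := fun n => by linarith [hN n]
  -- Tends to zero while `α ε ≤ 1 - α`, the condition under which the regularized production stays
  -- below its limit.
  let ε : ℕ → ℝ := fun n => (1 - α) / N n
  have hε0 : ∀ n, 0 < ε n := fun n => div_pos h2 (hN0 n)
  have hε1 : ∀ n, ε n ≤ 1 - α := fun n => div_le_self h2.le (by linarith [hN n])
  have hε : ∀ n, ε n ∈ Icc (0 : ℝ) 1 := fun n => ⟨(hε0 n).le, by linarith [hε1 n]⟩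
  have hαε : ∀ n, α * ε n ≤ 1 - α := fun n =>
    (mul_le_of_le_one_left (hε0 n).le hα.2.le).trans (hε1 n)
  have hεlim : Tendsto ε atTop (𝓝 0) := tendsto_const_nhds.div_atTop
    (tendsto_atTop_add_const_right _ _ tendsto_natCast_atTop_atTop)
  have jf := hf.hasParabolicJet.mono (subset_univ (Ioi 0))
  have jm := hasParabolicJet_equilibrium hσ hlam
  have pF : ∀ n t, 0 ≤ t → ∀ v ∈ Ioi (0 : ℝ), 0 < 1 * f t v + ε n * equilibrium σ lam v := by
    intro n t ht v hv
    have := hpos t ht v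
    have := equilibrium_pos hσ hlam hv
    have := hε0 n
    positivity
  have pG : ∀ t, 0 ≤ t → ∀ v ∈ Ioi (0 : ℝ), 0 < α * f t v + (1 - α) * equilibrium σ lam v := by
    intro t ht v hv
    have := hpos t ht v
    have := equilibrium_pos hσ hlam hv
    positivity
  -- The jet of the gap `√α f - √((f + ε m) (α f + (1 - α) m))`. The coefficient `1` of `f` is kept
  -- so that both factors are instances of `lincomb`.
  have jh := fun n => jf.lincomb
    ((jf.lincomb jm 1 (ε n)).sqrt_mul (jf.lincomb jm α (1 - α)) (pF n) pG) (√α) (-1)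
  have hbal := fun n => weak_balance (σ := σ) (lam := lam) hT (jh n)
    (isCutoff_inner (hN n)) (fun v hv => lt_of_lt_of_le (inv_pos.2 (hN0 n)) hv.1)
    (P := fun t v => σ / 8 * regProduction α (ε n) v (f t v) (deriv (f t) v)
      (equilibrium σ lam v) (equilibriumDeriv σ lam v))
    (fun t ht v _ => mul_nonneg (by positivity)
      (regProduction_nonneg hα (hε0 n).le (hpos t ht.le v) (hm0 v)))
    (fun t ht v hv => by
      have ef := hf.deriv_time_eq ht v
      have em := fokkerPlanckOp_equilibrium (lam := lam) hσ hv
      have key := fokkerPlanckOp_sqrt_mul (σ := σ) (lam := lam) (v := v) (pF n t ht.le v hv)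
        (pG t ht.le v hv)
        (Ft := 1 * deriv (fun s => f s v) t + ε n * 0)
        (Fv := 1 * deriv (f t) v + ε n * equilibriumDeriv σ lam v)
        (Fvv := 1 * deriv (deriv (f t)) v + ε n * equilibriumDerivTwo σ lam v)
        (Gt := α * deriv (fun s => f s v) t + (1 - α) * 0)
        (Gv := α * deriv (f t) v + (1 - α) * equilibriumDeriv σ lam v)
        (Gvv := α * deriv (deriv (f t)) v + (1 - α) * equilibriumDerivTwo σ lam v)
        (by
          rw [ef]; unfold fokkerPlanckOp at em ⊢; linear_combination -(ε n) * em)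
        (by
          rw [ef]; unfold fokkerPlanckOp at em ⊢; linear_combination -(1 - α) * em)
      -- The Wronskian is bilinear and alternating, so that of the two combinations is the
      -- determinant `1 · (1 - α) - ε α` times that of `f` and `m`.
      have hD : (1 * deriv (f t) v + ε n * equilibriumDeriv σ lam v)
            * (α * f t v + (1 - α) * equilibrium σ lam v)
          - (1 * f t v + ε n * equilibrium σ lam v)
            * (α * deriv (f t) v + (1 - α) * equilibriumDeriv σ lam v)
          = (1 - α - α * ε n) * (deriv (f t) v * equilibrium σ lam v
            - f t v * equilibriumDeriv σ lam v) := by ring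
      rw [hD] at key
      rw [key, ef, regProduction, one_mul (f t v)]
      simp only [fokkerPlanckOp]
      ring_nf)
  have hgap : ∀ n t v, √α * f t v + -1 * √((1 * f t v + ε n * equilibrium σ lam v)
        * (α * f t v + (1 - α) * equilibrium σ lam v)) =
      regGap α (ε n) (f t v) (equilibrium σ lam v) := by
    intro n t v
    rw [regGap, one_mul (f t v)]
    ring
  simp only [hgap, inner_adj_eq] at hbal
  have cgap : ∀ n, ContinuousOn (fun p : ℝ × ℝ => regGap α (ε n) (f p.1 p.2)
      (equilibrium σ lam p.2)) (Ioi 0 ×ˢ univ) := by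
    intro n
    have c0 := hf.continuousOn.mono (prod_mono Ioi_subset_Ici_self (le_refl univ))
    exact (continuous_regGap α).comp_continuousOn (continuousOn_const.prodMk
      (c0.prodMk (cm.comp continuous_snd).continuousOn))
  obtain ⟨C, hC, hB1, -, hB3⟩ := innerStep_tail σ lam
  have mtail : ∀ n, AEStronglyMeasurable (fun p : ℝ × ℝ => regGap α (ε n) (f p.1 p.2)
      (equilibrium σ lam p.2) * stepAdj σ lam (N n)⁻¹ p.2) (slab T) := fun n =>
    aestronglyMeasurable_slab ((cgap n).mul
      ((continuous_stepAdj σ lam (N n)⁻¹).comp continuous_snd).continuousOn)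
  have hH : Integrable (fun p : ℝ × ℝ => 2 * (f p.1 p.2 + equilibrium σ lam p.2)) (slab T) :=
    ((hf.integrable_slab T).add
      (integrable_slab_snd (integrable_equilibrium hσ hlam) T)).const_mul 2
  have hgle : ∀ n, ∀ᵐ p ∂(slab T), |regGap α (ε n) (f p.1 p.2) (equilibrium σ lam p.2)| ≤
      2 * (f p.1 p.2 + equilibrium σ lam p.2) := by
    intro n
    filter_upwards [ae_slab_pos T] with p hp
    exact abs_regGap_le hα (hε n).1 (hε n).2 (hpos p.1 hp.1.le p.2) (hm0 p.2)
  have htail := tendsto_slab_integral_tail (T := T)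
    (g := fun n p => regGap α (ε n) (f p.1 p.2) (equilibrium σ lam p.2))
    (B := fun n => stepAdj σ lam (N n)⁻¹) mtail hH hC
    (Eventually.of_forall fun n => by filter_upwards [hgle n] with p hp _ using hp)
    (Eventually.of_forall hB1) hB3
  obtain ⟨K1, hK1⟩ := (isCompact_Icc.prod isCompact_Icc :
    IsCompact (Icc 0 T ×ˢ Icc (0 : ℝ) 1)).exists_bound_of_continuousOn
    (hf.continuousOn.mono (prod_mono Icc_subset_Ici_self (subset_univ _)))
  obtain ⟨K2, hK2⟩ := (isCompact_Icc (a := (0 : ℝ)) (b := 1)).exists_bound_of_continuousOn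
    cm.continuousOn
  have hK1' : 0 ≤ K1 := (norm_nonneg _).trans (hK1 (0, 0) ⟨⟨le_rfl, hT.le⟩, by simp⟩)
  have hK2' : 0 ≤ K2 := (norm_nonneg _).trans (hK2 0 (by simp))
  -- `K1` and `K2` bound `f` on `[0, T] × [0, 1]`, initial time included, and `m` on `[0, 1]`; so `2
  -- f + m ≤ 2 K1 + K2`, uniformly in time and in `ε`.
  have horig := tendsto_slab_integral_origin (σ := σ) (lam := lam) (K := 2 * K1 + K2) hT cm
    (equilibrium_of_nonpos le_rfl)
    (g := fun n p => regGap α (ε n) (f p.1 p.2) (equilibrium σ lam p.2))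
    (fun n p hp1 hp2 => by
      refine (abs_regGap_le_sqrt hα (hε n).1 (hε n).2 (hpos p.1 hp1.1.le p.2) (hm0 p.2)).trans
        (Real.sqrt_le_sqrt (mul_le_mul_of_nonneg_right ?_ (hm0 p.2)))
      have e1 := (le_abs_self _).trans (hK1 p ⟨⟨hp1.1.le, hp1.2⟩, hp2⟩)
      have e2 := (le_abs_self _).trans (hK2 p.2 hp2)
      linarith) (by positivity)
  have hadj : ∀ n, ∫ p, regGap α (ε n) (f p.1 p.2) (equilibrium σ lam p.2)
      * (stepAdj σ lam (N n) p.2 - stepAdj σ lam (N n)⁻¹ p.2) ∂(slab T) =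
      ∫ p, regGap α (ε n) (f p.1 p.2) (equilibrium σ lam p.2) * stepAdj σ lam (N n) p.2 ∂(slab T)
      - ∫ p, regGap α (ε n) (f p.1 p.2) (equilibrium σ lam p.2)
        * stepAdj σ lam (N n)⁻¹ p.2 ∂(slab T) := by
    intro n
    have i2 : Integrable (fun p : ℝ × ℝ => regGap α (ε n) (f p.1 p.2) (equilibrium σ lam p.2)
        * stepAdj σ lam (N n)⁻¹ p.2) (slab T) := by
      refine Integrable.mono' (hH.mul_const C) (mtail n) ?_
      filter_upwards [hgle n] with p hp
      rw [norm_mul]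
      exact mul_le_mul hp (hB1 n p.2) (abs_nonneg _) ((abs_nonneg _).trans hp)
    have i1 : Integrable (fun p : ℝ × ℝ => regGap α (ε n) (f p.1 p.2) (equilibrium σ lam p.2)
        * stepAdj σ lam (N n) p.2) (slab T) := by
      refine ((hbal n).1.add i2).congr (ae_of_all _ fun p => ?_)
      simp only [Pi.add_apply]
      ring
    rw [← integral_sub i1 i2]
    exact integral_congr_ae (ae_of_all _ fun p => mul_sub _ _ _)
  have hX := (((hf.tendsto_integral_regGap hσ hlam hα le_rfl (hpos 0 le_rfl) hε hεlim).sub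
    (hf.tendsto_integral_regGap hσ hlam hα hT.le (hpos T hT.le) hε hεlim)).add
    (horig.sub htail))
  rw [sub_zero, add_zero] at hX
  replace hX := hX.congr (fun n => (congrArg _ (hadj n).symm).trans ((hbal n).2.2).symm)
  -- A zero of the nonnegative function `f t` is a minimum. This makes the production at zeros of
  -- `f` agree with the value `0` read there.
  have hx' : ∀ t, 0 ≤ t → ∀ v, f t v = 0 → deriv (f t) v = 0 :=
    fun t ht v h => deriv_eq_zero_of_eq_zero (hpos t ht) h
  refine integrable_of_tendsto_of_le (fun n => (hbal n).2.1) (fun n => ?_) (fun n => ?_) ?_ hX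
  · filter_upwards [ae_slab_pos T] with p hp
    exact mul_nonneg (mul_nonneg (by positivity)
      (regProduction_nonneg hα (hε0 n).le (hpos p.1 hp.1.le p.2) (hm0 p.2)))
      (innerCutoff_mem (by linarith [hN n]) p.2).1
  · filter_upwards [ae_slab_pos T] with p hp
    have hx := hpos p.1 hp.1.le p.2
    have hc := innerCutoff_mem (n := N n) (by linarith [hN n]) p.2
    rcases le_or_gt p.2 0 with hv | hv
    · rw [innerCutoff_eq_zero (by linarith [hN n])
        (fun h => by linarith [h.1, inv_pos.2 (hN0 n)]), mul_zero]
      exact mul_nonneg (by positivity) (regProduction_nonneg hα le_rfl hx (hm0 _))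
    · refine (mul_le_of_le_one_right (mul_nonneg (by positivity)
        (regProduction_nonneg hα (hε0 n).le hx (hm0 _))) hc.2).trans ?_
      exact mul_le_mul_of_nonneg_left (regProduction_le hα (hε0 n).le (hαε n) hx
        (equilibrium_pos hσ hlam hv) (hx' _ hp.1.le _)) (by positivity)
  · filter_upwards [ae_slab_pos T] with p hp
    have hx := hpos p.1 hp.1.le p.2
    rcases le_or_gt p.2 0 with hv | hv
    · have hz : ∀ n, innerCutoff (N n) p.2 = 0 := fun n => innerCutoff_eq_zero
        (by linarith [hN n]) (fun h => by linarith [h.1, inv_pos.2 (hN0 n)])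
      have hr : regProduction α 0 p.2 (f p.1 p.2) (deriv (f p.1) p.2) (equilibrium σ lam p.2)
          (equilibriumDeriv σ lam p.2) = 0 := by
        simp [regProduction, equilibriumDeriv, equilibrium_of_nonpos hv]
      rw [hr, mul_zero]
      refine tendsto_const_nhds.congr fun n => ?_
      exact (mul_eq_zero_of_right _ (hz n)).symm
    · have hl := ((tendsto_regProduction (v := p.2) (m' := equilibriumDeriv σ lam p.2) hα hx
        (equilibrium_pos hσ hlam hv) (hx' p.1 hp.1.le p.2)).comp hεlim).const_mul (σ / 8)
      refine hl.congr' ?_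
      filter_upwards [eventually_le_cast p.2, eventually_le_cast (2 / p.2)] with n hn hn'
      have : innerCutoff ((n : ℝ) + 2) p.2 = 1 := by
        refine innerCutoff_eq_one (by positivity) ?_ hn
        rwa [div_le_iff₀ hv] at hn'
      simp only [Function.comp_apply, N, this, mul_one]

end IsFokkerPlanckSolution

/-! ### The Hellinger distance -/

section Hellinger

variable {σ lam α : ℝ} {f₀ : ℝ → ℝ} {f : ℝ → ℝ → ℝ}

/-- At `ε = 0` the root in the gap is the cross term of the square; what remains is linear in `g`
and `h`, hence governed by masses alone. -/
lemma sq_sqrt_sub_sqrt_mix (hα : α ∈ Ioo (0 : ℝ) 1) {g h : ℝ → ℝ} {v : ℝ} (hg : 0 ≤ g v)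
    (hh : 0 ≤ h v) : (√(g v) - √(mix α g h v)) ^ 2 =
      (1 + α - 2 * √α) * g v + (1 - α) * h v + 2 * regGap α 0 (g v) (h v) := by
  have h1 : 0 < α := hα.1
  have h2 : 0 < 1 - α := by linarith [hα.2]
  have hmix : 0 ≤ mix α g h v := by rw [mix]; positivity
  rw [regGap, zero_mul, add_zero, sub_sq, Real.sq_sqrt hg, Real.sq_sqrt hmix, mul_assoc,
    ← Real.sqrt_mul hg, mix]
  ring

/-- Where `g > 0`, with `G` the mixture, `(log (g/G))' = (g' G - g G') / (g G)`, and the numerator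
is `1 - α` times the Wronskian of `g` and the equilibrium. -/
lemma hellingerProduction_eq (hσ : 0 < σ) (hlam : 0 < lam) (hα : α ∈ Ioo (0 : ℝ) 1)
    {g : ℝ → ℝ} (hg : ∀ v, 0 ≤ g v) {v : ℝ} (hv : 0 < v) (hd : DifferentiableAt ℝ g v) :
    hellingerProduction g (mix α g (equilibrium σ lam)) v =
      regProduction α 0 v (g v) (deriv g v) (equilibrium σ lam v) (equilibriumDeriv σ lam v) := by
  have h1 : 0 < α := hα.1
  have h2 : 0 < 1 - α := by linarith [hα.2]
  have hm := equilibrium_pos hσ hlam hv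
  rcases (hg v).eq_or_lt with h | h
  · rw [regProduction_eq_zero h.symm
      (IsFokkerPlanckSolution.deriv_eq_zero_of_eq_zero hg h.symm), hellingerProduction, ← h]
    simp
  · have hG : 0 < mix α g (equilibrium σ lam) v := by rw [mix]; positivity
    have d1 := hd.hasDerivAt
    have d2 : HasDerivAt (mix α g (equilibrium σ lam))
        (α * deriv g v + (1 - α) * equilibriumDeriv σ lam v) v :=
      (d1.const_mul α).add ((hasDerivAt_equilibrium hv).const_mul (1 - α))
    have d3 := ((d1.fun_div d2 hG.ne').log (div_pos h hG).ne').deriv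
    rw [hellingerProduction, d3, regProduction, zero_mul, add_zero, mul_zero, sub_zero]
    have hD : (1 - α) * (deriv g v * equilibrium σ lam v - g v * equilibriumDeriv σ lam v) =
        deriv g v * mix α g (equilibrium σ lam) v
          - g v * (α * deriv g v + (1 - α) * equilibriumDeriv σ lam v) := by
      rw [mix]; ring
    rw [hD]
    change _ = _ / (g v * mix α g (equilibrium σ lam) v * √(g v * mix α g (equilibrium σ lam) v))
    generalize mix α g (equilibrium σ lam) v = G at *
    have hr : 0 < √(g v * G) := Real.sqrt_pos.2 (mul_pos h hG)
    have hr2 : √(g v * G) ^ 2 = g v * G := Real.sq_sqrt (mul_pos h hG).le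
    generalize √(g v * G) = r at *
    field_simp
    rw [hr2]
    field_simp

lemma integrable_regGap (hσ : 0 < σ) (hlam : 0 < lam) (hα : α ∈ Ioo (0 : ℝ) 1) {g : ℝ → ℝ}
    (hg : ∀ v, 0 ≤ g v) (hc : Continuous g) (hi : Integrable g) :
    Integrable (fun v => regGap α 0 (g v) (equilibrium σ lam v)) := by
  have cm := continuous_equilibrium hσ hlam
  refine Integrable.mono' ((hi.add (integrable_equilibrium hσ hlam)).const_mul 2)
    (((continuous_regGap α).comp
      (continuous_const.prodMk (hc.prodMk cm))).aestronglyMeasurable) ?_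
  exact ae_of_all _ fun v =>
    abs_regGap_le hα le_rfl zero_le_one (hg v) (equilibrium_nonneg hσ hlam v)

lemma integrable_hellinger (hσ : 0 < σ) (hlam : 0 < lam) (hα : α ∈ Ioo (0 : ℝ) 1) {g : ℝ → ℝ}
    (hg : ∀ v, 0 ≤ g v) (hc : Continuous g) (hi : Integrable g) :
    Integrable (fun v => (√(g v) - √(mix α g (equilibrium σ lam) v)) ^ 2) := by
  simp only [sq_sqrt_sub_sqrt_mix hα (hg _) (equilibrium_nonneg hσ hlam _)]
  exact ((hi.const_mul _).add ((integrable_equilibrium hσ hlam).const_mul _)).add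
    ((integrable_regGap hσ hlam hα hg hc hi).const_mul 2)

lemma alphaHellingerDist_sq (hσ : 0 < σ) (hlam : 0 < lam) (hα : α ∈ Ioo (0 : ℝ) 1) {g : ℝ → ℝ}
    (hg : ∀ v, 0 ≤ g v) (hc : Continuous g) (hi : Integrable g) :
    alphaHellingerDist α g (equilibrium σ lam) ^ 2 =
      (1 + α - 2 * √α) * (∫ v, g v) + (1 - α) * (∫ v, equilibrium σ lam v)
        + 2 * ∫ v, regGap α 0 (g v) (equilibrium σ lam v) := by
  have im := integrable_equilibrium hσ hlam
  rw [alphaHellingerDist, hellingerDist, Real.sq_sqrt (integral_nonneg fun v => sq_nonneg _)]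
  simp only [sq_sqrt_sub_sqrt_mix hα (hg _) (equilibrium_nonneg hσ hlam _)]
  have i1 := hi.const_mul (1 + α - 2 * √α)
  have i2 := im.const_mul (1 - α)
  have i12 : Integrable fun v => (1 + α - 2 * √α) * g v + (1 - α) * equilibrium σ lam v := i1.add i2
  rw [integral_add i12 ((integrable_regGap hσ hlam hα hg hc hi).const_mul 2), integral_add i1 i2,
    integral_const_mul, integral_const_mul, integral_const_mul]

lemma hellingerProduction_nonneg (g h : ℝ → ℝ) (v : ℝ) : 0 ≤ hellingerProduction g h v := by
  unfold hellingerProduction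
  positivity

/-- The entropy balance over `(0, t]`, with the production integrated over the product set. -/
lemma IsFokkerPlanckSolution.hellinger_balance (hf : IsFokkerPlanckSolution σ lam f₀ f)
    (hσ : 0 < σ) (hlam : 0 < lam) (h0 : ∀ v, 0 ≤ f₀ v) (hα : α ∈ Ioo (0 : ℝ) 1) {t : ℝ}
    (ht : 0 ≤ t) (hpos : ∀ t, 0 ≤ t → ∀ v, 0 ≤ f t v) :
    IntegrableOn (fun p : ℝ × ℝ =>
      hellingerProduction (f p.1) (mix α (f p.1) (equilibrium σ lam)) p.2) (Ioc 0 t ×ˢ Ioi 0) ∧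
    alphaHellingerDist α (f t) (equilibrium σ lam) ^ 2 =
      alphaHellingerDist α (f 0) (equilibrium σ lam) ^ 2 - σ / 4 * ∫ p in Ioc 0 t ×ˢ Ioi 0,
        hellingerProduction (f p.1) (mix α (f p.1) (equilibrium σ lam)) p.2 := by
  rcases ht.eq_or_lt with rfl | ht'
  · simp
  obtain ⟨hi, he⟩ := hf.production_balance hσ hlam h0 hα ht'
  have hmeas : MeasurableSet (Ioc 0 t ×ˢ Ioi (0 : ℝ)) := measurableSet_Ioc.prod measurableSet_Ioi
  set R : ℝ × ℝ → ℝ := fun p => regProduction α 0 p.2 (f p.1 p.2) (deriv (f p.1) p.2)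
      (equilibrium σ lam p.2) (equilibriumDeriv σ lam p.2) with hR
  have hRi : Integrable R (slab t) := by
    refine (hi.const_mul (8 / σ)).congr (ae_of_all _ fun p => ?_)
    simp only [hR]
    field_simp
  have heq : EqOn R (fun p : ℝ × ℝ =>
      hellingerProduction (f p.1) (mix α (f p.1) (equilibrium σ lam)) p.2)
      (Ioc 0 t ×ˢ Ioi 0) := fun p hp =>
    (hellingerProduction_eq hσ hlam hα (hpos p.1 hp.1.1.le) hp.2
      (hf.differentiable hp.1.1 p.2).differentiableAt).symm
  -- On `v ≤ 0` the equilibrium and `equilibriumDeriv` are zero, so the Wronskian vanishes and the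
  -- integral over the line reduces to the half-line.
  have hRz : ∀ p, p ∉ (univ : Set ℝ) ×ˢ Ioi (0 : ℝ) → R p = 0 := by
    intro p hp
    have hv : p.2 ≤ 0 := not_lt.1 fun h => hp ⟨trivial, h⟩
    simp [hR, regProduction, equilibriumDeriv, equilibrium_of_nonpos hv]
  have hRon : IntegrableOn R (Ioc 0 t ×ˢ Ioi 0) := by
    rw [IntegrableOn, ← slab_restrict]; exact hRi.integrableOn
  refine ⟨hRon.congr_fun heq hmeas, ?_⟩
  rw [← setIntegral_congr_fun hmeas heq, ← slab_restrict,
    setIntegral_eq_integral_of_forall_compl_eq_zero hRz]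
  rw [integral_const_mul] at he
  rw [alphaHellingerDist_sq hσ hlam hα (hpos t ht) (hf.continuous_slice ht) (hf.integrable t ht),
    alphaHellingerDist_sq hσ hlam hα (hpos 0 le_rfl) (hf.continuous_slice le_rfl)
      (hf.integrable 0 le_rfl), hf.integral_eq ht']
  linarith

end Hellinger

/-! ### The main theorem -/

theorem theorem3p3 (σ lam : ℝ) (hσ : 0 < σ) (hlam : 0 < lam)
    (f₀ : ℝ → ℝ) (hf₀_smooth : ContDiff ℝ ∞ f₀) (hf₀_nonneg : ∀ v, 0 ≤ f₀ v)
    (hf₀_mass : ∫ v, f₀ v = 1) (hf₀_mean : ∫ v, v * f₀ v = 1)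
    (δ : ℝ) (hδ : 0 < δ) (hf₀_moment : Integrable (fun v : ℝ => |v| ^ (3 + δ) * f₀ v))
    (f : ℝ → ℝ → ℝ) (hf : IsFokkerPlanckSolution σ lam f₀ f)
    (α : ℝ) (hα : α ∈ Ioo (0 : ℝ) 1) :
    (∀ t, 0 ≤ t → ∀ v, 0 ≤ f t v) ∧
    (∀ t, 0 ≤ t → Integrable (fun v =>
      (√(f t v) - √(mix α (f t) (equilibrium σ lam) v)) ^ 2)) ∧
    AntitoneOn (fun t => alphaHellingerDist α (f t) (equilibrium σ lam)) (Ici 0) ∧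
    ∀ t, 0 ≤ t →
      IntegrableOn (fun p : ℝ × ℝ =>
        hellingerProduction (f p.1) (mix α (f p.1) (equilibrium σ lam)) p.2)
        (Ioc 0 t ×ˢ Ioi 0) ∧
      alphaHellingerDist α (f t) (equilibrium σ lam) ^ 2 =
        alphaHellingerDist α f₀ (equilibrium σ lam) ^ 2
          - σ / 4 * ∫ s in (0 : ℝ)..t, ∫ v in Ioi (0 : ℝ),
              hellingerProduction (f s) (mix α (f s) (equilibrium σ lam)) v := by
  have hpos : ∀ t, 0 ≤ t → ∀ v, 0 ≤ f t v := by
    intro t ht v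
    rcases ht.eq_or_lt with h | h
    · rw [← h, hf.initial]; exact hf₀_nonneg v
    · exact hf.nonneg hσ hlam hf₀_nonneg h v
  have hbal := fun t (ht : 0 ≤ t) => hf.hellinger_balance hσ hlam hf₀_nonneg hα ht hpos
  have hinit : f 0 = f₀ := funext hf.initial
  refine ⟨hpos, fun t ht => integrable_hellinger hσ hlam hα (hpos t ht)
    (hf.continuous_slice ht) (hf.integrable t ht), ?_, fun t ht => ⟨(hbal t ht).1, ?_⟩⟩
  · intro s hs t ht hst
    refine (pow_le_pow_iff_left₀ (Real.sqrt_nonneg _) (Real.sqrt_nonneg _) two_ne_zero).1 ?_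
    have h1 := (hbal s hs).2
    have h2 := (hbal t ht).2
    -- Both squared distances are compared with the one at time zero; the production accumulated up
    -- to `s` is at most that up to `t`, by nonnegativity.
    have h3 := setIntegral_mono_set (hbal t ht).1
      (ae_of_all _ fun p => hellingerProduction_nonneg _ _ _)
      (LE.le.eventuallyLE
        (prod_mono (Ioc_subset_Ioc_right hst) (le_refl (Ioi (0 : ℝ)))))
    have h4 := mul_le_mul_of_nonneg_left h3 (by positivity : 0 ≤ σ / 4)
    change alphaHellingerDist α (f t) (equilibrium σ lam) ^ 2 ≤
      alphaHellingerDist α (f s) (equilibrium σ lam) ^ 2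
    linarith
  · have h := (hbal t ht).2
    have hi := (hbal t ht).1
    rw [Measure.volume_eq_prod] at hi h
    rw [setIntegral_prod _ hi] at h
    rw [h, hinit, intervalIntegral.integral_of_le ht]
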